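/- All posets are finite. An element $x$ of a lattice is reducible if $x=y\vee z$ or $x=y\wedge z$ for some $y,z\neq x$. A block is a lattice whose least element $0$ and greatest element $1$ are both reducible (equivalently, a maximal block: the middle part $\mathbf B$ of a linear sum $C\oplus\mathbf B\oplus C'$ with $C,C'$ possibly empty chains). The nullity of a poset is the nullity (number of edges minus number of vertices plus number of connected components) of its cover graph. The height of a poset is the maximal number of coverings in a maximal chain. In a poset $P$ let $Red(P)$ be the set of the elements with at least two lower covers or at least two upper covers. An element $x$ with exactly one lower and exactly one upper cover is retractible if either there are no $y,z\in Red(P)$ with $y\prec x\prec z$, or there are $y,z\in Red(P)$ with $y\prec x\prec z$ and $y\prec x\prec z$ is the only directed path from $y$ to $z$ in the cover graph. The basic block associated to $P$ is the poset obtained from $P$ by successively removing retractible elements as long as there are any, and then successively removing pendant vertices of the cover graph as long as there are any. For a poset $P$ and $a<b$ in $P$ with $b$ not covering $a$, the adjunct $P]_a^b\{c\}$ is $P\cup\{c\}$ with $x\le c$ iff $x\le a$ and $c\le x$ iff $b\le x$, for $x\in P$. Let $C: 0\prec a\prec b\prec c\prec 1$ be a $5$-chain and put $$B_1=C]_0^b\{c_1\}]_a^c\{c_2\}]_a^1\{c_3\},\quad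 B_3=C]_0^b\{c_1\}]_a^c\{c_2\}]_0^1\{c_3\},$$ $$B_5=C]_0^b\{c_1\}]_a^c\{c_2\}]_b^1\{c_3\},\quad B_6=C]_0^c\{c_1\}]_a^1\{c_2\}]_b^1\{c_3\},$$ and let $B_2,B_4,B_7$ be the duals of $B_1,B_3,B_6$ respectively. For $j\ge 8$ let $\mathscr B(j;5,3,4)$ be the class of all blocks on $j$ elements, up to isomorphism, that have exactly five reducible elements, which are pairwise comparable, that have nullity $3$, and whose associated basic block has height $4$. For $1\le i\le 7$ let $\mathbb B_i(j;5,3)$ be the class of all blocks on $j$ elements, up to isomorphism, with exactly five reducible elements, which are pairwise comparable, with nullity $3$, and whose associated basic block is isomorphic to $B_i$. Theorem. For every integer $j\ge 8$, $$|\mathscr B(j;5,3,4)|=2\binom{j-2}{6}+\sum_{s=1}^{j-7}\ \sum_{t=1}^{j-s-6}5\binom{j-t-s-2}{4},$$ and $$|\mathscr B(j;5,3,4)|=\sum_{i=1}^{7}|\mathbb B_i(j;5,3)|.$$ -/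

import Mathlib

namespace LatticeCount

/-! ### Posets: cover graph, nullity, irreducible and reducible elements -/

section Poset

variable (P : Type*) [PartialOrder P]

/-- The nullity (cycle rank) of a finite poset: that of its cover graph,
`#edges - #vertices + #connected components`. -/
noncomputable def nullity : ℤ :=
  ((SimpleGraph.hasse P).edgeSet.ncard : ℤ) - (Nat.card P : ℤ)
    + (Nat.card (SimpleGraph.hasse P).ConnectedComponent : ℤ)

/-- The elements with at most one lower cover and at most one upper cover. -/
def posetIrr : Set P :=
  {x | {y : P | y ⋖ x}.Subsingleton ∧ {z : P | x ⋖ z}.Subsingleton}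

/-- The elements with at least two lower covers or at least two upper covers. -/
def posetRed : Set P := (posetIrr P)ᶜ

variable {P}

/-- A directed path from `y` to `z` in the cover graph, each vertex being covered by the next. -/
def IsDirectedPath (y z : P) (l : List P) : Prop :=
  l.IsChain (fun a b => a ⋖ b) ∧ l.head? = some y ∧ l.getLast? = some z

/-- An element with exactly one lower and exactly one upper cover is retractible if either it does
not lie directly between two reducible elements, or it does and the path through it is the only
directed path between these two. -/
def Retractible (x : P) : Prop :=
  ((∃! y : P, y ⋖ x) ∧ (∃! z : P, x ⋖ z)) ∧
    ((¬ ∃ y ∈ posetRed P, ∃ z ∈ posetRed P, y ⋖ x ∧ x ⋖ z) ∨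
      ∃ y ∈ posetRed P, ∃ z ∈ posetRed P, y ⋖ x ∧ x ⋖ z ∧
        ∀ l : List P, IsDirectedPath y z l → l = [y, x, z])

/-- A pendant vertex of the cover graph. -/
def Pendant (x : P) : Prop := ((SimpleGraph.hasse P).neighborSet x).ncard = 1

/-- `T` is obtained from the subposet `S` (with the induced order) by removal of one retractible
element of `S`. -/
def RetractStep (S T : Set P) : Prop := ∃ x : S, Retractible x ∧ T = S \ {(x : P)}

/-- `T` is obtained from the subposet `S` (with the induced order) by removal of one pendant
vertex of `S`. -/
def PendantStep (S T : Set P) : Prop := ∃ x : S, Pendant x ∧ T = S \ {(x : P)}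

/-- `R` is a basic retract associated to `P`: what is left of `P` after successive removal of
all the retractible elements. -/
def IsBasicRetractOf (R : Set P) : Prop :=
  Relation.ReflTransGen RetractStep (Set.univ : Set P) R ∧ ∀ x : R, ¬ Retractible x

/-- `B` is a basic block associated to `P`: what is left of a basic retract associated to `P`
after successive removal of all the pendant vertices. -/
def IsBasicBlockOf (B : Set P) : Prop :=
  ∃ R : Set P, IsBasicRetractOf R ∧
    Relation.ReflTransGen PendantStep R B ∧ ∀ x : B, ¬ Pendant x

end Poset

/-! ### Adjuncts of posets -/

/-- The adjunct `P ]_a^b Q` of `Q` to `P` with respect to the pair `(a, b)` of `P`, where `a < b`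
and `b` does not cover `a`: the disjoint union of `P` and `Q`, with `Q` placed above `a` and
below `b`. -/
structure Adjunct (P Q : Type) [PartialOrder P] (a b : P) (h : ∃ c, a < c ∧ c < b) : Type where
  val : P ⊕ Q

section Adjunct

variable {P Q : Type} [PartialOrder P] [PartialOrder Q] {a b : P} {h : ∃ c, a < c ∧ c < b}

/-- The element of the adjunct given by an element of the first poset. -/
def Adjunct.left (x : P) : Adjunct P Q a b h := ⟨Sum.inl x⟩

/-- The order of an adjunct. -/
def Adjunct.le : P ⊕ Q → P ⊕ Q → Prop
  | .inl x, .inl y => x ≤ y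
  | .inr x, .inr y => x ≤ y
  | .inl x, .inr _ => x ≤ a
  | .inr _, .inl y => b ≤ y

instance : PartialOrder (Adjunct P Q a b h) where
  le x y := Adjunct.le (a := a) (b := b) x.val y.val
  le_refl := by rintro ⟨x | x⟩ <;> exact le_refl x
  le_trans := by
    obtain ⟨c, h1, h2⟩ := h
    rintro ⟨x | x⟩ ⟨y | y⟩ ⟨z | z⟩ hxy hyz
    · exact le_trans (α := P) hxy hyz
    · exact le_trans (α := P) hxy hyz
    · exact le_trans (α := P) hxy (le_trans (h1.trans h2).le hyz)
    · exact hxy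
    · exact le_trans (α := P) hxy hyz
    · exact absurd (le_trans (α := P) hxy hyz) (h1.trans h2).not_ge
    · exact hyz
    · exact le_trans (α := Q) hxy hyz
  le_antisymm := by
    obtain ⟨c, h1, h2⟩ := h
    rintro ⟨x | x⟩ ⟨y | y⟩ hxy hyx
    · exact congrArg (fun t => (⟨Sum.inl t⟩ : Adjunct P Q a b _)) (le_antisymm (α := P) hxy hyx)
    · exact absurd (le_trans (α := P) hyx hxy) (h1.trans h2).not_ge
    · exact absurd (le_trans (α := P) hxy hyx) (h1.trans h2).not_ge
    · exact congrArg (fun t => (⟨Sum.inr t⟩ : Adjunct P Q a b _)) (le_antisymm (α := Q) hxy hyx)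

theorem Adjunct.left_lt_left {x y : P} (hxy : x < y) :
    (Adjunct.left x : Adjunct P Q a b h) < Adjunct.left y :=
  ⟨hxy.le, fun hyx : y ≤ x => hxy.not_ge hyx⟩

theorem Adjunct.exists_between_left {x y : P} (hxy : ∃ c, x < c ∧ c < y) :
    ∃ c, (Adjunct.left x : Adjunct P Q a b h) < c ∧ c < Adjunct.left y :=
  let ⟨c, h₁, h₂⟩ := hxy
  ⟨.left c, left_lt_left h₁, left_lt_left h₂⟩

end Adjunct

/-- The `5`-chain `0 ≺ a ≺ b ≺ c ≺ 1` (here `Fin 5`) with three one-element chains adjoined at the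
pairs `(x₁, y₁)`, `(x₂, y₂)`, `(x₃, y₃)` of the `5`-chain. -/
abbrev TripleAdjunct (x₁ y₁ x₂ y₂ x₃ y₃ : Fin 5) (h₁ : ∃ c, x₁ < c ∧ c < y₁)
    (h₂ : ∃ c, x₂ < c ∧ c < y₂) (h₃ : ∃ c, x₃ < c ∧ c < y₃) : Type :=
  Adjunct
    (Adjunct (Adjunct (Fin 5) Unit x₁ y₁ h₁) Unit (.left x₂) (.left y₂)
      (Adjunct.exists_between_left h₂))
    Unit (.left (.left x₃)) (.left (.left y₃))
    (Adjunct.exists_between_left (Adjunct.exists_between_left h₃))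

/-- The basic block `B₁ = C ]_0^b {c₁} ]_a^c {c₂} ]_a^1 {c₃}`. -/
abbrev B₁ : Type := TripleAdjunct 0 2 1 3 1 4 (by decide) (by decide) (by decide)

/-- The basic block `B₃ = C ]_0^b {c₁} ]_a^c {c₂} ]_0^1 {c₃}`. -/
abbrev B₃ : Type := TripleAdjunct 0 2 1 3 0 4 (by decide) (by decide) (by decide)

/-- The basic block `B₅ = C ]_0^b {c₁} ]_a^c {c₂} ]_b^1 {c₃}`. -/
abbrev B₅ : Type := TripleAdjunct 0 2 1 3 2 4 (by decide) (by decide) (by decide)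

/-- The basic block `B₆ = C ]_0^c {c₁} ]_a^1 {c₂} ]_b^1 {c₃}`. -/
abbrev B₆ : Type := TripleAdjunct 0 3 1 4 2 4 (by decide) (by decide) (by decide)

/-- The seven basic blocks `B₁, …, B₇` of height four; `B₂`, `B₄`, `B₇` are the duals of
`B₁`, `B₃`, `B₆`. -/
def basicBlock : Fin 7 → PartOrd.{0} :=
  ![.of B₁, .of B₁ᵒᵈ, .of B₃, .of B₃ᵒᵈ, .of B₅, .of B₆, .of B₆ᵒᵈ]

/-! ### Lattices: reducible elements, blocks -/

section Lattice

variable {L : Type*} [Lattice L]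

/-- `x` is the join of two elements distinct from `x`. -/
def JoinReducible (x : L) : Prop := ∃ y z : L, y ≠ x ∧ z ≠ x ∧ y ⊔ z = x

/-- `x` is the meet of two elements distinct from `x`. -/
def MeetReducible (x : L) : Prop := ∃ y z : L, y ≠ x ∧ z ≠ x ∧ y ⊓ z = x

variable (L)

/-- The set of reducible elements of a lattice. -/
def Red : Set L := {x | JoinReducible x ∨ MeetReducible x}

/-- A block: a lattice with `0` and `1` in which `0` and `1` are reducible. -/
def IsBlock : Prop := (∃ x ∈ Red L, IsBot x) ∧ (∃ x ∈ Red L, IsTop x)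

end Lattice

/-! ### Isomorphism classes of finite lattices -/

/-- A lattice structure on the set `Fin n`. -/
structure FinLattice (n : ℕ) where
  lattice : Lattice (Fin n)

/-- The underlying set of a lattice on `n` elements (without the usual order of `Fin n`). -/
def FinLattice.Carrier {n : ℕ} (_ : FinLattice n) : Type := Fin n

instance {n : ℕ} (L : FinLattice n) : Lattice L.Carrier := L.lattice

instance {n : ℕ} (L : FinLattice n) : Fintype L.Carrier := inferInstanceAs (Fintype (Fin n))

/-- Isomorphism of lattices on `n` elements. -/
instance isoSetoid (n : ℕ) : Setoid (FinLattice n) where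
  r L M := Nonempty (L.Carrier ≃o M.Carrier)
  iseqv :=
    { refl := fun _ => ⟨OrderIso.refl _⟩
      symm := fun ⟨e⟩ => ⟨e.symm⟩
      trans := fun ⟨e⟩ ⟨f⟩ => ⟨e.trans f⟩ }

/-- The isomorphism classes of lattices on `n` elements. -/
abbrev IsoClass (n : ℕ) : Type := Quotient (isoSetoid n)

/-- A block with exactly `r` reducible elements, pairwise comparable, and of nullity `k`. -/
structure IsBlockOfType (L : Type*) [Lattice L] (r k : ℕ) : Prop where
  isBlock : IsBlock L
  card_red : (Red L).ncard = r
  comparable : IsChain (· ≤ ·) (Red L)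
  nullity_eq : nullity L = k

/-- The class `𝓑(j; r, k, h)` of maximal blocks on `j` elements, up to isomorphism, with `r`
comparable reducible elements and of nullity `k`, whose associated basic block has height `h`. -/
def blockClass (j r k h : ℕ) : Set (IsoClass j) :=
  {q | ∃ L : FinLattice j, ⟦L⟧ = q ∧ IsBlockOfType L.Carrier r k ∧
    ∃ B : Set L.Carrier, IsBasicBlockOf B ∧ Order.krullDim B = h}

/-- The class of maximal blocks on `j` elements, up to isomorphism, with `r` comparable reducible
elements and of nullity `k`, whose associated basic block is isomorphic to `X`. -/
def blockClassOf (X : PartOrd.{0}) (j r k : ℕ) : Set (IsoClass j) :=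
  {q | ∃ L : FinLattice j, ⟦L⟧ = q ∧ IsBlockOfType L.Carrier r k ∧
    ∃ B : Set L.Carrier, IsBasicBlockOf B ∧ Nonempty (B ≃o X)}

end LatticeCount

namespace LatticeCount

/-! In a finite block whose five reducible elements form a chain, the join and the meet of two
incomparable elements are reducible, hence lie in that chain. So the block is the `5`-chain together
with disjoint chains hanging between pairs of its members, and an element off the chain is located
by the indices of the nearest members below and above it. `Coord` axiomatises this. `exists_coord`
extracts it from a block, and `Coord.toLattice` shows that nothing else is needed to have a lattice.

A hanging chain is essential if some element incomparable to it fits between its ends. Retraction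
shrinks each essential hanging chain to one element and deletes the others. No vertex is ever
pendant, so the second phase of the reduction does nothing (`represents_of_isBasicBlockOf`). If two
parallel chains hung between consecutive members, a surviving element would lengthen the `5`-chain,
so height four excludes this (`consecTotal_of_krullDim_eq`). The nullity is then the number of
chains hanging between nonconsecutive members (`nullity_eq_ncard_tops`).

Nullity three thus allows at most three nonconsecutive pairs, and reducibility forces every member
of the `5`-chain to be an end of one of them. A finite check leaves seven sets of pairs, each with
exactly three elements (`exists_eq_supp`); they are those of the seven basic blocks. The three
chains therefore use distinct pairs, and the block is determined by the numbers of elements with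
given indices. These numbers are isomorphism invariants, because the `5`-chain is intrinsic
(`count_eq_of_orderIso`).

For a fixed basic block, the `j - 8` further elements are distributed freely over seven slots: its
three pairs and the four consecutive ones. This gives `(j - 2).choose 6` classes. The double sum in
the theorem is `5 * (j - 2).choose 6` by summing twice along a diagonal of Pascal's triangle. -/

/-- Coordinates on a poset made of a `5`-chain `r 0 < ⋯ < r 4` and of chains hanging between
members of it: `lo x` and `hi x` are the indices of the closest members below and above `x`, and
elements with equal indices are comparable exactly if they lie on the same hanging chain. -/
structure Coord (P : Type*) [PartialOrder P] where
  r : Fin 5 → P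
  lo : P → Fin 5
  hi : P → Fin 5
  lo_r : ∀ i, lo (r i) = i
  hi_r : ∀ i, hi (r i) = i
  lo_le_hi : ∀ x, lo x ≤ hi x
  eq_r : ∀ x, lo x = hi x → x = r (lo x)
  le_of : ∀ {x y}, hi x ≤ lo y → x ≤ y
  of_le : ∀ {x y}, x ≤ y → hi x ≤ lo y ∨ (lo x = lo y ∧ hi x = hi y)
  up_total : ∀ {x y z}, lo x = lo z → hi x = hi z → lo y = lo z → hi y = hi z →
    x ≤ z → y ≤ z → x ≤ y ∨ y ≤ x
  down_total : ∀ {x y z}, lo x = lo z → hi x = hi z → lo y = lo z → hi y = hi z →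
    z ≤ x → z ≤ y → x ≤ y ∨ y ≤ x

namespace Coord

/-! ### Coordinates, hanging chains and essential elements -/

section Basic

variable {P Q : Type*} [PartialOrder P] [PartialOrder Q] (C : Coord P)

/-- The coordinates of a subposet that contains the chain. -/
@[simps] def restrict (S : Set P) (h : ∀ i, C.r i ∈ S) : Coord S where
  r i := ⟨C.r i, h i⟩
  lo x := C.lo x
  hi x := C.hi x
  lo_r i := C.lo_r i
  hi_r i := C.hi_r i
  lo_le_hi x := C.lo_le_hi x
  eq_r x hx := Subtype.ext (C.eq_r x hx)
  le_of h := C.le_of h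
  of_le h := C.of_le h
  up_total h1 h2 h3 h4 h5 h6 := C.up_total h1 h2 h3 h4 h5 h6
  down_total h1 h2 h3 h4 h5 h6 := C.down_total h1 h2 h3 h4 h5 h6

/-- Transport of coordinates along an isomorphism. -/
@[simps] def map (e : P ≃o Q) : Coord Q where
  r i := e (C.r i)
  lo x := C.lo (e.symm x)
  hi x := C.hi (e.symm x)
  lo_r i := by simp [C.lo_r]
  hi_r i := by simp [C.hi_r]
  lo_le_hi x := C.lo_le_hi _
  eq_r x hx := by rw [← C.eq_r _ hx]; simp
  le_of h := e.symm.le_iff_le.1 (C.le_of h)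
  of_le h := C.of_le (e.symm.le_iff_le.2 h)
  up_total h1 h2 h3 h4 h5 h6 := by
    simpa using C.up_total h1 h2 h3 h4 (e.symm.le_iff_le.2 h5) (e.symm.le_iff_le.2 h6)
  down_total h1 h2 h3 h4 h5 h6 := by
    simpa using C.down_total h1 h2 h3 h4 (e.symm.le_iff_le.2 h5) (e.symm.le_iff_le.2 h6)

variable {C} {x y z : P} {i k : Fin 5}

theorem r_le_iff : C.r i ≤ x ↔ i ≤ C.lo x := by
  constructor
  · intro h
    rcases C.of_le h with h | h
    · rwa [C.hi_r] at h
    · rw [← h.1, C.lo_r]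
  · intro h
    exact C.le_of (by rwa [C.hi_r])

theorem le_r_iff : x ≤ C.r i ↔ C.hi x ≤ i := by
  constructor
  · intro h
    rcases C.of_le h with h | h
    · rwa [C.lo_r] at h
    · rw [h.2, C.hi_r]
  · intro h
    exact C.le_of (by rwa [C.lo_r])

theorem r_lo_le (C : Coord P) (x : P) : C.r (C.lo x) ≤ x := r_le_iff.2 le_rfl

theorem le_r_hi (C : Coord P) (x : P) : x ≤ C.r (C.hi x) := le_r_iff.2 le_rfl

theorem lo_mono (h : x ≤ y) : C.lo x ≤ C.lo y := r_le_iff.1 ((C.r_lo_le x).trans h)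

theorem hi_mono (h : x ≤ y) : C.hi x ≤ C.hi y := le_r_iff.1 (h.trans (C.le_r_hi y))

theorem r_le_r : C.r i ≤ C.r k ↔ i ≤ k := by rw [r_le_iff, C.lo_r]

theorem r_strictMono (C : Coord P) : StrictMono C.r :=
  strictMono_of_le_iff_le fun _ _ => r_le_r.symm

theorem lo_lt_hi_iff : C.lo x < C.hi x ↔ x ∉ Set.range C.r := by
  constructor
  · rintro h ⟨i, rfl⟩
    simp [C.lo_r, C.hi_r] at h
  · intro h
    refine lt_of_le_of_ne (C.lo_le_hi x) fun e => h ⟨_, (C.eq_r x e).symm⟩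

theorem r_lo_lt (h : C.lo x < C.hi x) : C.r (C.lo x) < x :=
  lt_of_le_of_ne (C.r_lo_le x) fun e => lo_lt_hi_iff.1 h ⟨_, e⟩

theorem lt_r_hi (h : C.lo x < C.hi x) : x < C.r (C.hi x) :=
  lt_of_le_of_ne (C.le_r_hi x) fun e => lo_lt_hi_iff.1 h ⟨_, e.symm⟩

/-- Two elements on the same hanging chain. -/
def Same (C : Coord P) (x y : P) : Prop :=
  C.lo x = C.lo y ∧ C.hi x = C.hi y ∧ (x ≤ y ∨ y ≤ x)

theorem Same.refl (C : Coord P) (x : P) : C.Same x x := ⟨rfl, rfl, Or.inl le_rfl⟩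

theorem Same.symm (h : C.Same x y) : C.Same y x := ⟨h.1.symm, h.2.1.symm, h.2.2.symm⟩

/-- When `x` and `z` are on the same side of `y`, transitivity of the order says nothing; these two
cases are what `up_total` and `down_total` are for. -/
theorem Same.trans (h : C.Same x y) (h' : C.Same y z) : C.Same x z := by
  obtain ⟨h1, h2, h3⟩ := h
  obtain ⟨h4, h5, h6⟩ := h'
  refine ⟨h1.trans h4, h2.trans h5, ?_⟩
  rcases h3 with h3 | h3 <;> rcases h6 with h6 | h6
  · exact Or.inl (h3.trans h6)
  · exact C.up_total h1 h2 h4.symm h5.symm h3 h6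
  · exact C.down_total h1 h2 h4.symm h5.symm h3 h6
  · exact Or.inr (h6.trans h3)

theorem same_of_le (h : x ≤ y) (h' : ¬ C.hi x ≤ C.lo y) : C.Same x y := by
  rcases C.of_le h with h1 | h1
  · exact absurd h1 h'
  · exact ⟨h1.1, h1.2, Or.inl h⟩

/-- An element is essential if some element incomparable to it lies between the same members of the
chain. -/
def Ess (C : Coord P) (x : P) : Prop :=
  ∃ y, ¬ x ≤ y ∧ ¬ y ≤ x ∧ C.lo x ≤ C.lo y ∧ C.hi y ≤ C.hi x

/-- Each member of the chain bounds an essential element. -/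
def Good (C : Coord P) : Prop := ∀ i, ∃ x, C.Ess x ∧ (C.lo x = i ∨ C.hi x = i)

theorem Ess.lo_lt_hi (h : C.Ess x) : C.lo x < C.hi x := by
  obtain ⟨y, h1, h2, h3, h4⟩ := h
  refine lt_of_le_of_ne (C.lo_le_hi x) fun e => h1 (C.le_of (e ▸ h3))

/-- A witness with strictly narrower indices produces a member of the `5`-chain strictly between the
ends; otherwise it lies on a parallel hanging chain. In this form essentiality visibly depends only
on the hanging chain of `x`. -/
theorem ess_iff : C.Ess x ↔
    (∃ i, C.lo x < i ∧ i < C.hi x) ∨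
      ∃ y, C.lo y = C.lo x ∧ C.hi y = C.hi x ∧ ¬ x ≤ y ∧ ¬ y ≤ x := by
  constructor
  · rintro ⟨y, h1, h2, h3, h4⟩
    have h5 : ¬ C.hi x ≤ C.lo y := fun h => h1 (C.le_of h)
    have h6 : ¬ C.hi y ≤ C.lo x := fun h => h2 (C.le_of h)
    by_cases h7 : C.lo x < C.lo y
    · exact Or.inl ⟨_, h7, not_le.1 h5⟩
    by_cases h8 : C.hi y < C.hi x
    · exact Or.inl ⟨_, not_le.1 h6, h8⟩
    exact Or.inr ⟨y, le_antisymm (not_lt.1 h7) h3, le_antisymm h4 (not_lt.1 h8), h1, h2⟩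
  · rintro (⟨i, h1, h2⟩ | ⟨y, h1, h2, h3, h4⟩)
    · refine ⟨C.r i, ?_, ?_, ?_, ?_⟩
      · rw [le_r_iff]; exact not_le.2 h2
      · rw [r_le_iff]; exact not_le.2 h1
      · rw [C.lo_r]; exact h1.le
      · rw [C.hi_r]; exact h2.le
    · exact ⟨y, h3, h4, h1.ge, h2.le⟩

theorem Ess.of_same (h : C.Ess x) (h' : C.Same x y) : C.Ess y := by
  rw [ess_iff] at h ⊢
  rw [← h'.1, ← h'.2.1]
  rcases h with h | ⟨z, h1, h2, h3, h4⟩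
  · exact Or.inl h
  · refine Or.inr ⟨z, h1, h2, ?_, ?_⟩ <;> intro h5
    · have := h'.trans ⟨h'.1.symm.trans h1.symm, h'.2.1.symm.trans h2.symm, Or.inl h5⟩
      exact this.2.2.elim h3 h4
    · have := h'.trans ⟨h'.1.symm.trans h1.symm, h'.2.1.symm.trans h2.symm, Or.inr h5⟩
      exact this.2.2.elim h3 h4

end Basic

/-! ### Covers in terms of coordinates -/

section Covers

variable {P : Type*} [PartialOrder P] {C : Coord P} {x y z : P} {i k : Fin 5}

theorem eq_of_covBy_of_covBy_of_le (hx : x ⋖ z) (hy : y ⋖ z) (h : x ≤ y) : x = y :=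
  (hx.eq_or_eq h hy.le).elim Eq.symm fun e => absurd e hy.ne

theorem eq_of_covBy_of_covBy_of_le_up (hx : z ⋖ x) (hy : z ⋖ y) (h : x ≤ y) : x = y :=
  (hy.eq_or_eq hx.le h).elim (fun e => absurd e hx.ne') id

/-- A cover of `x` is either the upper end of its hanging chain or the next element on that chain.
Any two candidates are comparable, and comparable covers coincide. -/
theorem upper_cover_unique (hx : C.lo x < C.hi x) (hy : x ⋖ y) (hz : x ⋖ z) : y = z := by
  have key : ∀ {y z}, x ⋖ y → x ⋖ z → C.hi x ≤ C.lo y → y ≤ z ∨ z ≤ y := by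
    intro y z hy hz h
    have e : y = C.r (C.hi x) :=
      ((hy.eq_or_eq (C.le_r_hi x) (r_le_iff.2 h)).resolve_left (lt_r_hi hx).ne').symm
    by_cases h' : C.hi x ≤ C.lo z
    · exact Or.inl (e ▸ r_le_iff.2 h')
    · have := same_of_le hz.le h'
      exact Or.inr (e ▸ le_r_iff.2 this.2.1.ge)
  have : y ≤ z ∨ z ≤ y := by
    by_cases h1 : C.hi x ≤ C.lo y
    · exact key hy hz h1
    by_cases h2 : C.hi x ≤ C.lo z
    · exact (key hz hy h2).symm
    have h1 := same_of_le hy.le h1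
    have h2 := same_of_le hz.le h2
    exact (h1.symm.trans h2).2.2
  exact this.elim (eq_of_covBy_of_covBy_of_le_up hy hz)
    fun h => (eq_of_covBy_of_covBy_of_le_up hz hy h).symm

theorem lower_cover_unique (hx : C.lo x < C.hi x) (hy : y ⋖ x) (hz : z ⋖ x) : y = z := by
  have key : ∀ {y z}, y ⋖ x → z ⋖ x → C.hi y ≤ C.lo x → y ≤ z ∨ z ≤ y := by
    intro y z hy hz h
    have e : y = C.r (C.lo x) :=
      ((hy.eq_or_eq (le_r_iff.2 h) (C.r_lo_le x)).resolve_right (r_lo_lt hx).ne).symm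
    by_cases h' : C.hi z ≤ C.lo x
    · exact Or.inr (e ▸ le_r_iff.2 h')
    · have := same_of_le hz.le h'
      exact Or.inl (e ▸ r_le_iff.2 this.1.ge)
  have : y ≤ z ∨ z ≤ y := by
    by_cases h1 : C.hi y ≤ C.lo x
    · exact key hy hz h1
    by_cases h2 : C.hi z ≤ C.lo x
    · exact (key hz hy h2).symm
    have h1 := same_of_le hy.le h1
    have h2 := same_of_le hz.le h2
    exact (h1.trans h2.symm).2.2
  exact this.elim (eq_of_covBy_of_covBy_of_le hy hz)
    fun h => (eq_of_covBy_of_covBy_of_le hz hy h).symm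

theorem mem_posetIrr_of_lo_lt_hi (hx : C.lo x < C.hi x) : x ∈ posetIrr P :=
  ⟨fun _ h _ h' => lower_cover_unique hx h h', fun _ h _ h' => upper_cover_unique hx h h'⟩

variable [Finite P]

theorem exists_upper_cover (hx : C.lo x < C.hi x) : ∃ y, x ⋖ y ∧ y ≤ C.r (C.hi x) :=
  exists_covBy_le_of_lt (lt_r_hi hx)

theorem exists_lower_cover (hx : C.lo x < C.hi x) : ∃ y, C.r (C.lo x) ≤ y ∧ y ⋖ x :=
  exists_le_covBy_of_lt (r_lo_lt hx)

/-- Climb from the lower end towards `x` and towards the witness `w`. A common first step would lie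
on the hanging chains of both, making `x` and `w` comparable. -/
theorem Ess.exists_two_upper_covers (h : C.Ess x) :
    ∃ y z, C.r (C.lo x) ⋖ y ∧ C.r (C.lo x) ⋖ z ∧ y ≠ z := by
  obtain ⟨w, h1, h2, h3, h4⟩ := h
  have hw : C.r (C.lo x) < w := lt_of_le_of_ne (r_le_iff.2 h3) fun e => h2 (e ▸ C.r_lo_le x)
  have hx : C.r (C.lo x) < x := lt_of_le_of_ne (C.r_lo_le x) fun e => h1 (e ▸ r_le_iff.2 h3)
  obtain ⟨y, hy, hyx⟩ := exists_covBy_le_of_lt hx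
  obtain ⟨z, hz, hzw⟩ := exists_covBy_le_of_lt hw
  refine ⟨y, z, hy, hz, ?_⟩
  rintro rfl
  have hs : C.Same y x := same_of_le hyx fun h => hy.lt.not_ge (le_r_iff.2 h)
  have hs' : C.Same y w := same_of_le hzw fun h => h1 (C.le_of (hs.2.1 ▸ h))
  exact (hs.symm.trans hs').2.2.elim h1 h2

theorem Ess.exists_two_lower_covers (h : C.Ess x) :
    ∃ y z, y ⋖ C.r (C.hi x) ∧ z ⋖ C.r (C.hi x) ∧ y ≠ z := by
  obtain ⟨w, h1, h2, h3, h4⟩ := h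
  have hw : w < C.r (C.hi x) := lt_of_le_of_ne (le_r_iff.2 h4) fun e => h1 (e ▸ C.le_r_hi x)
  have hx : x < C.r (C.hi x) := lt_of_le_of_ne (C.le_r_hi x) fun e => h2 (e ▸ le_r_iff.2 h4)
  obtain ⟨y, hyx, hy⟩ := exists_le_covBy_of_lt hx
  obtain ⟨z, hzw, hz⟩ := exists_le_covBy_of_lt hw
  refine ⟨y, z, hy, hz, ?_⟩
  rintro rfl
  have hs : C.Same x y := same_of_le hyx fun h => hy.lt.not_ge (r_le_iff.2 h)
  have hs' : C.Same w y := same_of_le hzw fun h => h2 (C.le_of (hs.1 ▸ h))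
  exact (hs.trans hs'.symm).2.2.elim h1 h2

theorem Good.posetRed_eq (hC : C.Good) : posetRed P = Set.range C.r := by
  ext x
  constructor
  · intro h
    by_contra h'
    exact h (mem_posetIrr_of_lo_lt_hi (lo_lt_hi_iff.2 h'))
  · rintro ⟨i, rfl⟩ ⟨h1, h2⟩
    obtain ⟨x, hx, rfl | rfl⟩ := hC i
    · obtain ⟨y, z, hy, hz, hne⟩ := hx.exists_two_upper_covers
      exact hne (h2 hy hz)
    · obtain ⟨y, z, hy, hz, hne⟩ := hx.exists_two_lower_covers
      exact hne (h1 hy hz)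

end Covers

end Coord

/-! ### Directed paths in the cover graph -/

section Paths

variable {P : Type*} [PartialOrder P] {a b c : P} {l : List P}

theorem IsDirectedPath.cons (h : a ⋖ b) (hl : IsDirectedPath b c l) :
    IsDirectedPath a c (a :: l) := by
  obtain ⟨h1, h2, h3⟩ := hl
  cases l with
  | nil => simp at h2
  | cons d t =>
    obtain rfl : d = b := by simpa using h2
    exact ⟨List.isChain_cons_cons.2 ⟨h, h1⟩, rfl, by simpa using h3⟩

theorem exists_directedPath_mem [Finite P] (hab : a ≤ b) (hbc : b ≤ c) :
    ∃ l, IsDirectedPath a c l ∧ b ∈ l := by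
  induction a using WellFoundedGT.induction generalizing b with
  | ind a ih =>
    rcases hab.eq_or_lt with rfl | hab
    · rcases hbc.eq_or_lt with rfl | hbc
      · exact ⟨[a], by simp [IsDirectedPath], by simp⟩
      · obtain ⟨d, had, hdc⟩ := exists_covBy_le_of_lt hbc
        obtain ⟨l, hl, -⟩ := ih d had.lt le_rfl hdc
        exact ⟨a :: l, hl.cons had, by simp⟩
    · obtain ⟨d, had, hdb⟩ := exists_covBy_le_of_lt hab
      obtain ⟨l, hl, hb⟩ := ih d had.lt hdb hbc
      exact ⟨a :: l, hl.cons had, by simp [hb]⟩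

theorem IsDirectedPath.le (h : IsDirectedPath a c l) : a ≤ c := by
  induction l generalizing a with
  | nil => simp [IsDirectedPath] at h
  | cons d t ih =>
    obtain ⟨h1, h2, h3⟩ := h
    obtain rfl : d = a := by simpa using h2
    cases t with
    | nil => exact le_of_eq (by simpa using h3)
    | cons e t =>
      rw [List.isChain_cons_cons] at h1
      exact h1.1.le.trans (ih ⟨h1.2, rfl, by simpa using h3⟩)

theorem IsDirectedPath.exists_tail (h : IsDirectedPath a c l) (hac : a ≠ c) :
    ∃ d t, a ⋖ d ∧ IsDirectedPath d c t ∧ l = a :: t := by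
  obtain ⟨h1, h2, h3⟩ := h
  match l, h1, h2, h3 with
  | [], _, h2, _ => simp at h2
  | [d], _, h2, h3 => exact absurd ((by simpa using h2 : d = a).symm.trans (by simpa using h3)) hac
  | d :: e :: t, h1, h2, h3 =>
    obtain rfl : d = a := by simpa using h2
    rw [List.isChain_cons_cons] at h1
    exact ⟨e, e :: t, h1.1, ⟨h1.2, rfl, by simpa using h3⟩, rfl⟩

theorem IsDirectedPath.eq_singleton (h : IsDirectedPath a a l) : l = [a] := by
  obtain ⟨h1, h2, h3⟩ := h
  match l, h1, h2, h3 with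
  | [], _, h2, _ => simp at h2
  | [d], _, h2, _ => simpa using h2
  | d :: e :: t, h1, h2, h3 =>
    obtain rfl : d = a := by simpa using h2
    rw [List.isChain_cons_cons] at h1
    have : IsDirectedPath e d (e :: t) := ⟨h1.2, rfl, by simpa using h3⟩
    exact absurd this.le h1.1.lt.not_ge

end Paths

namespace Coord

/-! ### Retractible elements -/

section Retract

variable {P : Type*} [PartialOrder P] [Finite P] {C : Coord P} {x y z : P}

theorem lo_lt_hi_of_retractible (hC : C.Good) (hx : Retractible x) : C.lo x < C.hi x := by
  rw [lo_lt_hi_iff, ← hC.posetRed_eq]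
  intro h
  exact h ⟨fun _ h1 _ h2 => hx.1.1.unique h1 h2, fun _ h1 _ h2 => hx.1.2.unique h1 h2⟩

/-- Retraction never removes the last element of an essential hanging chain. If `x` is not directly
between reducible elements, one of its covers is off the `5`-chain and so on the same hanging chain.
The other alternative cannot occur: the witness of essentiality lies on a second path. -/
theorem exists_same_ne_of_retractible (hC : C.Good) (hx : Retractible x) (he : C.Ess x) :
    ∃ y, y ≠ x ∧ C.Same x y := by
  have hlt := lo_lt_hi_of_retractible hC hx
  obtain ⟨⟨⟨y, hy, -⟩, ⟨z, hz, -⟩⟩, h⟩ := hx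
  rw [hC.posetRed_eq] at h
  rcases h with h | ⟨y, ⟨i, rfl⟩, z, ⟨k, rfl⟩, hy, hz, h⟩
  · by_cases hy' : y ∈ Set.range C.r
    · have hz' : z ∉ Set.range C.r := fun hz' => h ⟨y, hy', z, hz', hy, hz⟩
      refine ⟨z, hz.ne', same_of_le hz.le fun h1 => hz' ⟨C.hi x, ?_⟩⟩
      exact (hz.eq_or_eq (C.le_r_hi x) (r_le_iff.2 h1)).resolve_left (lt_r_hi hlt).ne'
    · refine ⟨y, hy.ne, Same.symm (same_of_le hy.le fun h1 => hy' ⟨C.lo x, ?_⟩)⟩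
      exact (hy.eq_or_eq (le_r_iff.2 h1) (C.r_lo_le x)).resolve_right (r_lo_lt hlt).ne
  · exfalso
    have hi : i ≤ C.lo x := r_le_iff.1 hy.le
    have hk : C.hi x ≤ k := le_r_iff.1 hz.le
    obtain ⟨w, h1, h2, h3, h4⟩ := he
    have hw : C.r i ≤ w := r_le_iff.2 (hi.trans h3)
    have hw' : w ≤ C.r k := le_r_iff.2 (h4.trans hk)
    obtain ⟨l, hl, hwl⟩ := exists_directedPath_mem hw hw'
    rw [h l hl] at hwl
    simp only [List.mem_cons, List.not_mem_nil, or_false] at hwl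
    rcases hwl with rfl | rfl | rfl
    · exact h2 hy.le
    · exact h1 le_rfl
    · exact h1 hz.le

/-- The smaller of two elements of a hanging chain has its upper cover on that chain, hence
irreducible, and is retractible by the first alternative. -/
theorem not_lt_of_same_of_forall_not_retractible (hC : C.Good) (h : ∀ x : P, ¬ Retractible x)
    (hxy : C.Same x y) : ¬ x < y := by
  intro hlt
  have hx : C.lo x < C.hi x := by
    refine lt_of_le_of_ne (C.lo_le_hi x) fun e => hlt.ne ?_
    rw [C.eq_r x e, C.eq_r y (hxy.1.symm.trans (e.trans hxy.2.1)), hxy.1]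
  obtain ⟨w, hw, hwy⟩ := exists_covBy_le_of_lt hlt
  obtain ⟨v, -, hv⟩ := exists_lower_cover hx
  refine h x ⟨⟨⟨v, hv, fun _ h' => lower_cover_unique hx h' hv⟩,
    ⟨w, hw, fun _ h' => upper_cover_unique hx h' hw⟩⟩, Or.inl ?_⟩
  rintro ⟨-, -, z, hz, -, hxz⟩
  obtain rfl := upper_cover_unique hx hw hxz
  rw [hC.posetRed_eq] at hz
  obtain ⟨i, rfl⟩ := hz
  have h1 := le_r_iff.1 hw.le
  have h2 := r_le_iff.1 hwy
  rw [← hxy.1] at h2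
  exact absurd (h1.trans h2) hx.not_ge

theorem eq_of_same_of_forall_not_retractible (hC : C.Good) (h : ∀ x : P, ¬ Retractible x)
    (hxy : C.Same x y) : x = y := by
  rcases hxy.2.2 with h1 | h1
  · exact h1.eq_of_not_lt (not_lt_of_same_of_forall_not_retractible hC h hxy)
  · exact (h1.eq_of_not_lt (not_lt_of_same_of_forall_not_retractible hC h hxy.symm)).symm

/-- Between the ends of an inessential hanging chain everything is comparable to `x`. With hanging
chains already reduced to single elements, the path through `x` is the only one and `x` is
retractible by the second alternative. -/
theorem ess_of_forall_not_retractible (hC : C.Good) (h : ∀ x : P, ¬ Retractible x)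
    (hx : C.lo x < C.hi x) : C.Ess x := by
  by_contra he
  have hbetween : ∀ y, C.lo x ≤ C.lo y → C.hi y ≤ C.hi x →
      y = C.r (C.lo x) ∨ y = x ∨ y = C.r (C.hi x) := by
    intro y h1 h2
    by_cases h3 : C.hi y ≤ C.lo x
    · exact Or.inl (le_antisymm (le_r_iff.2 h3) (r_le_iff.2 h1))
    by_cases h4 : C.hi x ≤ C.lo y
    · exact Or.inr (Or.inr (le_antisymm (le_r_iff.2 h2) (r_le_iff.2 h4)))
    have hc : x ≤ y ∨ y ≤ x := by
      by_contra hc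
      exact he ⟨y, fun h => hc (Or.inl h), fun h => hc (Or.inr h), h1, h2⟩
    rcases hc with hc | hc
    · exact Or.inr (Or.inl
        (eq_of_same_of_forall_not_retractible hC h (same_of_le hc h4)).symm)
    · exact Or.inr (Or.inl (eq_of_same_of_forall_not_retractible hC h (same_of_le hc h3)))
  have hlo : C.r (C.lo x) ⋖ x := by
    obtain ⟨y, hy, hyx⟩ := exists_lower_cover hx
    rcases hbetween y (r_le_iff.1 hy) (hi_mono hyx.le) with rfl | rfl | rfl
    · exact hyx
    · exact absurd rfl hyx.ne
    · exact absurd (lt_r_hi hx) hyx.lt.asymm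
  have hhi : x ⋖ C.r (C.hi x) := by
    obtain ⟨y, hxy, hy⟩ := exists_upper_cover hx
    rcases hbetween y (lo_mono hxy.le) (le_r_iff.1 hy) with rfl | rfl | rfl
    · exact absurd (r_lo_lt hx) hxy.lt.asymm
    · exact absurd rfl hxy.ne
    · exact hxy
  refine h x ⟨⟨⟨_, hlo, fun _ h' => lower_cover_unique hx h' hlo⟩,
    ⟨_, hhi, fun _ h' => upper_cover_unique hx h' hhi⟩⟩, Or.inr ?_⟩
  rw [hC.posetRed_eq]
  refine ⟨_, ⟨_, rfl⟩, _, ⟨_, rfl⟩, hlo, hhi, ?_⟩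
  intro l hl
  obtain ⟨d, t, h1, h2, rfl⟩ := hl.exists_tail (hlo.lt.trans hhi.lt).ne
  obtain rfl : d = x := by
    rcases hbetween d (r_le_iff.1 h1.le) (le_r_iff.1 h2.le) with e | e | e
    · exact absurd e h1.ne'
    · exact e
    · exact absurd hhi.lt (h1.2 hlo.lt |>.comp (e ▸ id))
  obtain ⟨e, s, h3, h4, rfl⟩ := h2.exists_tail hhi.ne
  obtain rfl := upper_cover_unique hx h3 hhi
  rw [h4.eq_singleton]

/-- No vertex of the cover graph is pendant. -/
theorem not_pendant (hC : C.Good) (x : P) : ¬ Pendant x := by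
  have key : ∃ y z, y ≠ z ∧ (SimpleGraph.hasse P).Adj x y ∧ (SimpleGraph.hasse P).Adj x z := by
    by_cases hx : C.lo x < C.hi x
    · obtain ⟨y, -, hy⟩ := exists_lower_cover hx
      obtain ⟨z, hz, -⟩ := exists_upper_cover hx
      exact ⟨y, z, (hy.lt.trans hz.lt).ne, Or.inr hy, Or.inl hz⟩
    · rw [lo_lt_hi_iff, not_not] at hx
      obtain ⟨i, rfl⟩ := hx
      obtain ⟨x, hx, rfl | rfl⟩ := hC i
      · obtain ⟨y, z, hy, hz, hne⟩ := hx.exists_two_upper_covers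
        exact ⟨y, z, hne, Or.inl hy, Or.inl hz⟩
      · obtain ⟨y, z, hy, hz, hne⟩ := hx.exists_two_lower_covers
        exact ⟨y, z, hne, Or.inr hy, Or.inr hz⟩
  intro hp
  obtain ⟨a, ha⟩ := Set.ncard_eq_one.1 hp
  obtain ⟨y, z, hne, hy, hz⟩ := key
  have hy : y ∈ (SimpleGraph.hasse P).neighborSet x := hy
  have hz : z ∈ (SimpleGraph.hasse P).neighborSet x := hz
  rw [ha] at hy hz
  exact hne (hy.trans hz.symm)

end Retract

/-! ### What survives retraction -/

section Represents

variable {P : Type*} [PartialOrder P] {C : Coord P} {x y z : P} {S T : Set P}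

/-- A subset that contains the chain and a representative of each essential hanging chain. -/
def Represents (C : Coord P) (S : Set P) : Prop :=
  (∀ i, C.r i ∈ S) ∧ ∀ x, C.Ess x → ∃ y ∈ S, C.Same x y

theorem represents_univ (C : Coord P) : C.Represents Set.univ :=
  ⟨fun _ => trivial, fun x _ => ⟨x, trivial, Same.refl C x⟩⟩

/-- Essentiality is not lost by passing to `S`: a parallel witness `y` is itself essential, with
witness `x`, so its hanging chain still has a representative in `S`. -/
theorem Represents.ess_restrict_iff (h : C.Represents S) {x : S} :
    (C.restrict S h.1).Ess x ↔ C.Ess x := by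
  constructor
  · rintro ⟨y, hy⟩
    exact ⟨y, hy⟩
  · intro hx
    have hx' := hx
    rw [ess_iff] at hx ⊢
    rcases hx with hx | ⟨y, h1, h2, h3, h4⟩
    · exact Or.inl hx
    · right
      obtain ⟨y', hy', hs⟩ := h.2 y ⟨x, h4, h3, h1.le, h2.ge⟩
      have hns : ¬ C.Same x y' := fun hn => (hn.trans hs.symm).2.2.elim h3 h4
      have e1 : C.lo x = C.lo y' := h1.symm.trans hs.1
      have e2 : C.hi x = C.hi y' := h2.symm.trans hs.2.1
      exact ⟨⟨y', hy'⟩, e1.symm, e2.symm, fun h => hns ⟨e1, e2, Or.inl h⟩,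
        fun h => hns ⟨e1, e2, Or.inr h⟩⟩

theorem Represents.good_restrict (h : C.Represents S) (hC : C.Good) :
    (C.restrict S h.1).Good := by
  intro i
  obtain ⟨x, hx, hi⟩ := hC i
  obtain ⟨y, hy, hs⟩ := h.2 x hx
  refine ⟨⟨y, hy⟩, h.ess_restrict_iff.2 (hx.of_same hs), ?_⟩
  simpa [← hs.1, ← hs.2.1] using hi

variable [Finite P]

theorem Represents.of_retractStep (h : C.Represents S) (hC : C.Good) (hST : RetractStep S T) :
    C.Represents T := by
  obtain ⟨x, hx, rfl⟩ := hST
  have hlt := lo_lt_hi_of_retractible (h.good_restrict hC) hx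
  refine ⟨fun i => ⟨h.1 i, ?_⟩, fun z hz => ?_⟩
  · intro e
    rw [Set.mem_singleton_iff] at e
    have : C.lo x < C.hi x := hlt
    rw [← e, C.lo_r, C.hi_r] at this
    exact lt_irrefl _ this
  · obtain ⟨y, hy, hs⟩ := h.2 z hz
    by_cases hyx : y = x
    · obtain ⟨w, hwx, hw⟩ := exists_same_ne_of_retractible (h.good_restrict hC) hx
        (h.ess_restrict_iff.2 (hyx ▸ hz.of_same hs))
      refine ⟨w, ⟨w.2, fun e => hwx (Subtype.ext e)⟩, hs.trans ?_⟩
      rw [hyx]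
      exact hw
    · exact ⟨y, ⟨hy, hyx⟩, hs⟩

theorem represents_of_isBasicBlockOf (hC : C.Good) (hB : IsBasicBlockOf S) :
    C.Represents S ∧ ∀ x : S, ¬ Retractible x := by
  obtain ⟨R, ⟨hR, hR'⟩, hRS, -⟩ := hB
  have h : C.Represents R := by
    clear hR' hRS
    induction hR with
    | refl => exact represents_univ C
    | tail _ h2 ih => exact ih.of_retractStep hC h2
  rcases hRS.cases_head with rfl | ⟨T, ⟨x, hx, -⟩, -⟩
  · exact ⟨h, hR'⟩
  · exact absurd hx (not_pendant (h.good_restrict hC) x)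

end Represents

end Coord

/-! ### Existence of a basic block -/

section Existence

theorem exists_reflTransGen_of_ssubset {P : Type*} [Finite P] {r : Set P → Set P → Prop}
    (hr : ∀ S T, r S T → T ⊂ S) (S : Set P) :
    ∃ T, Relation.ReflTransGen r S T ∧ ∀ U, ¬ r T U := by
  induction S using WellFoundedLT.induction with
  | ind S ih =>
    by_cases h : ∃ U, r S U
    · obtain ⟨U, hU⟩ := h
      obtain ⟨T, hT, hT'⟩ := ih U (hr S U hU)
      exact ⟨T, hT.head hU, hT'⟩
    · exact ⟨S, .refl, not_exists.1 h⟩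

theorem exists_isBasicBlockOf (P : Type*) [PartialOrder P] [Finite P] :
    ∃ B : Set P, IsBasicBlockOf B := by
  have key : ∀ {S : Set P} (x : S), S \ {(x : P)} ⊂ S := fun x =>
    Set.sdiff_singleton_ssubset.2 x.2
  obtain ⟨R, hR, hR'⟩ := exists_reflTransGen_of_ssubset (r := RetractStep (P := P))
    (by rintro S T ⟨x, -, rfl⟩; exact key x) Set.univ
  obtain ⟨B, hB, hB'⟩ := exists_reflTransGen_of_ssubset (r := PendantStep (P := P))
    (by rintro S T ⟨x, -, rfl⟩; exact key x) R
  exact ⟨B, R, ⟨hR, fun x hx => hR' _ ⟨x, hx, rfl⟩⟩, hB, fun x hx => hB' _ ⟨x, hx, rfl⟩⟩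

end Existence

/-! ### The cover graph and the nullity -/

section Hasse

variable {P : Type*} [PartialOrder P]

theorem ncard_edgeSet_hasse :
    (SimpleGraph.hasse P).edgeSet.ncard = {p : P × P | p.1 ⋖ p.2}.ncard := by
  symm
  refine Set.ncard_congr (fun p _ => s(p.1, p.2)) (fun p hp => Or.inl hp) ?_ ?_
  · rintro ⟨a, b⟩ ⟨c, d⟩ h1 h2 h
    rcases Sym2.eq_iff.1 h with ⟨rfl, rfl⟩ | ⟨rfl, rfl⟩
    · rfl
    · exact absurd (CovBy.lt h1) (CovBy.lt h2).asymm
  · intro e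
    induction e with
    | h a b =>
      rintro (h | h)
      · exact ⟨(a, b), h, rfl⟩
      · exact ⟨(b, a), h, Sym2.eq_swap⟩

theorem card_connectedComponent_hasse [Finite P] {a : P} (ha : IsBot a) :
    Nat.card (SimpleGraph.hasse P).ConnectedComponent = 1 := by
  have h : ∀ x : P, (SimpleGraph.hasse P).Reachable a x := by
    intro x
    induction x using WellFoundedLT.induction with
    | ind x ih =>
      rcases (ha x).eq_or_lt with rfl | hx
      · exact SimpleGraph.Reachable.refl _
      · obtain ⟨y, -, hy⟩ := exists_le_covBy_of_lt hx
        exact (ih y hy.lt).trans (SimpleGraph.Adj.reachable (Or.inl hy))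
  have hpre : (SimpleGraph.hasse P).Preconnected := fun x y => (h x).symm.trans (h y)
  have : Subsingleton (SimpleGraph.hasse P).ConnectedComponent :=
    hpre.subsingleton_connectedComponent
  exact Nat.card_eq_one_iff_unique.2 ⟨this, ⟨SimpleGraph.connectedComponentMk _ a⟩⟩

end Hasse

namespace Coord

variable {P : Type*} [PartialOrder P] {C : Coord P} {x y z : P}

theorem isBot_r_zero (C : Coord P) : IsBot (C.r 0) := fun _ => r_le_iff.2 (Fin.zero_le _)

theorem isTop_r_last (C : Coord P) : IsTop (C.r 4) := fun _ => le_r_iff.2 (Fin.le_last _)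

/-- At most one hanging chain lies between two consecutive members of the chain. -/
def ConsecTotal (C : Coord P) : Prop :=
  ∀ x y, C.lo x = C.lo y → C.hi x = C.hi y → (C.hi x : ℕ) = C.lo x + 1 → x ≤ y ∨ y ≤ x

/-- The greatest elements of the hanging chains between nonconsecutive members of the chain. -/
def Tops (C : Coord P) : Set P := {x | (C.lo x : ℕ) + 1 < C.hi x ∧ x ⋖ C.r (C.hi x)}

/-- The edges split in two. Those in `E₁` correspond, by their upper ends, to the vertices other
than the least one and so form a spanning tree in number; those in `E₂`, by their lower ends, to the
tops of the far hanging chains. The cover graph being connected, the nullity counts `E₂`. -/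
theorem nullity_eq_ncard_tops [Finite P] (hC : C.ConsecTotal) : nullity P = (C.Tops.ncard : ℤ) := by
  set E : Set (P × P) := {p | p.1 ⋖ p.2} with hE
  set E₁ : Set (P × P) := {p | p.1 ⋖ p.2 ∧ (C.lo p.2 < C.hi p.2 ∨ (C.hi p.1 : ℕ) ≤ C.lo p.1 + 1)}
    with hE₁
  set E₂ : Set (P × P) := {p | p.1 ⋖ p.2 ∧ C.lo p.2 = C.hi p.2 ∧ (C.lo p.1 : ℕ) + 1 < C.hi p.1}
    with hE₂
  have hunion : E = E₁ ∪ E₂ := by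
    ext p
    have := C.lo_le_hi p.2
    simp only [hE, hE₁, hE₂, Set.mem_ofPred_eq, Set.mem_union]
    grind
  have hdisj : Disjoint E₁ E₂ := by
    rw [Set.disjoint_left]
    rintro p ⟨-, h1⟩ ⟨-, h2, h3⟩
    grind
  have hcover : ∀ {x k}, x ⋖ C.r k → C.lo x < C.hi x → C.hi x = k := by
    intro x k h hx
    have h1 : C.r (C.hi x) ≤ C.r k := r_le_r.2 (le_r_iff.1 h.le)
    exact C.r_strictMono.injective
      ((h.eq_or_eq (C.le_r_hi x) h1).resolve_left (lt_r_hi hx).ne')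
  have hcard₂ : E₂.ncard = C.Tops.ncard := by
    refine Set.ncard_congr (fun p _ => p.1) ?_ ?_ ?_
    · rintro ⟨x, y⟩ ⟨h1, h2, h3⟩
      dsimp only at h1 h2 h3 ⊢
      rw [C.eq_r y h2] at h1
      refine ⟨h3, ?_⟩
      rwa [hcover h1 (Fin.lt_def.2 (by omega))]
    · rintro ⟨x, y⟩ ⟨x', y'⟩ ⟨h1, h2, h3⟩ ⟨h1', h2', h3'⟩ h
      dsimp only at h1 h2 h3 h1' h2' h3' h
      subst h
      rw [upper_cover_unique (C := C) (Fin.lt_def.2 (by omega)) h1 h1']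
    · rintro x ⟨h1, h2⟩
      exact ⟨(x, C.r (C.hi x)), ⟨h2, by rw [C.lo_r, C.hi_r], h1⟩, rfl⟩
  have hcard₁ : E₁.ncard = ({C.r 0}ᶜ : Set P).ncard := by
    -- Hence the lower end of an edge of `E₁` into `C.r k` has lower index `k - 1`: it is either the
    -- preceding member or on a chain hanging between these two consecutive members, where
    -- `ConsecTotal` leaves only one candidate.
    have hlo : ∀ {x k}, x ⋖ C.r k → (C.hi x : ℕ) ≤ C.lo x + 1 → (k : ℕ) ≤ C.lo x + 1 := by
      intro x k h hx
      by_cases hx' : C.lo x < C.hi x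
      · rw [← hcover h hx']
        exact hx
      · by_contra hk
        have hlt : (C.lo x : ℕ) + 1 < 5 := by omega
        have e : x = C.r (C.lo x) := C.eq_r x (le_antisymm (C.lo_le_hi x) (not_lt.1 hx'))
        rw [e] at h
        refine h.2 (c := C.r ⟨C.lo x + 1, hlt⟩) (C.r_strictMono ?_) (C.r_strictMono ?_) <;>
          rw [Fin.lt_def] <;> dsimp only <;> omega
    refine Set.ncard_congr (fun p _ => p.2) ?_ ?_ ?_
    · rintro ⟨x, y⟩ ⟨h1, -⟩ h
      rw [Set.mem_singleton_iff] at h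
      dsimp only at h h1
      exact (h ▸ h1.lt).not_ge (C.isBot_r_zero x)
    · rintro ⟨x, y⟩ ⟨x', y'⟩ ⟨h1, h2⟩ ⟨h1', h2'⟩ h
      dsimp only at h1 h2 h1' h2' h
      subst h
      by_cases hy : C.lo y < C.hi y
      · rw [lower_cover_unique hy h1 h1']
      have e : y = C.r (C.lo y) := C.eq_r y (le_antisymm (C.lo_le_hi y) (not_lt.1 hy))
      generalize C.lo y = k at e
      subst e
      replace h2 := h2.resolve_left hy
      replace h2' := h2'.resolve_left hy
      have h3 := hlo h1 h2
      have h3' := hlo h1' h2'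
      have h4 := le_r_iff.1 h1.le
      have h4' := le_r_iff.1 h1'.le
      have h5 := C.lo_le_hi x
      have h5' := C.lo_le_hi x'
      rw [Fin.le_def] at h4 h4' h5 h5'
      have hlk : C.lo x < k := by
        refine lt_of_le_of_ne (Fin.le_def.2 (h5.trans h4)) ?_
        rintro rfl
        exact h1.lt.not_ge (C.r_lo_le x)
      have hlk' : C.lo x' < k := by
        refine lt_of_le_of_ne (Fin.le_def.2 (h5'.trans h4')) ?_
        rintro rfl
        exact h1'.lt.not_ge (C.r_lo_le x')
      rw [Fin.lt_def] at hlk hlk'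
      have hll : C.lo x = C.lo x' := Fin.ext (by omega)
      have hc : x ≤ x' ∨ x' ≤ x := by
        by_cases hx : (C.hi x : ℕ) = C.lo x
        · exact Or.inl (C.le_of (by rw [← hll, Fin.ext hx]))
        by_cases hx' : (C.hi x' : ℕ) = C.lo x'
        · exact Or.inr (C.le_of (by rw [hll, Fin.ext hx']))
        exact hC x x' hll (Fin.ext (by omega)) (by omega)
      rcases hc with hc | hc
      · rw [eq_of_covBy_of_covBy_of_le h1 h1' hc]
      · rw [eq_of_covBy_of_covBy_of_le h1' h1 hc]
    · intro y hy
      by_cases hy' : C.lo y < C.hi y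
      · obtain ⟨x, -, hx⟩ := exists_lower_cover hy'
        exact ⟨(x, y), ⟨hx, Or.inl hy'⟩, rfl⟩
      have e : y = C.r (C.lo y) := C.eq_r y (le_antisymm (C.lo_le_hi y) (not_lt.1 hy'))
      generalize C.lo y = k at e
      subst e
      have hk : k ≠ 0 := by
        rintro rfl
        exact hy rfl
      have hk' : (k : ℕ) ≠ 0 := fun h => hk (Fin.ext h)
      have hlt : C.r ⟨k - 1, by omega⟩ < C.r k :=
        C.r_strictMono (Fin.lt_def.2 (by dsimp only; omega))
      obtain ⟨x, h1, h2⟩ := exists_le_covBy_of_lt hlt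
      refine ⟨(x, C.r k), ⟨h2, Or.inr ?_⟩, rfl⟩
      have h3 := Fin.le_def.1 (r_le_iff.1 h1)
      have h4 := Fin.le_def.1 (le_r_iff.1 h2.le)
      dsimp only at h3 ⊢
      omega
  have h1 := Set.ncard_union_eq hdisj (Set.toFinite _) (Set.toFinite _)
  rw [← hunion, hcard₂, hcard₁] at h1
  have h2 := Set.ncard_add_ncard_compl ({C.r 0} : Set P)
  rw [Set.ncard_singleton] at h2
  rw [nullity, ncard_edgeSet_hasse, card_connectedComponent_hasse C.isBot_r_zero, h1, ← h2]
  push_cast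
  ring

theorem Ess.lo_add_one_lt_hi (hx : C.Ess x) (hC : C.ConsecTotal) :
    (C.lo x : ℕ) + 1 < C.hi x := by
  have h := Fin.lt_def.1 hx.lo_lt_hi
  rcases ess_iff.1 hx with ⟨i, h1, h2⟩ | ⟨y, h1, h2, h3, h4⟩
  · rw [Fin.lt_def] at h1 h2
    omega
  · by_contra h5
    exact (hC x y h1.symm h2.symm (by omega)).elim h3 h4

theorem ess_of_lo_add_one_lt_hi (hx : (C.lo x : ℕ) + 1 < C.hi x) : C.Ess x :=
  ess_iff.2 (Or.inl ⟨⟨C.lo x + 1, by omega⟩, Fin.lt_def.2 (by dsimp only; omega),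
    Fin.lt_def.2 (by dsimp only; omega)⟩)

theorem exists_same_mem_tops [Finite P] (hx : (C.lo x : ℕ) + 1 < C.hi x) : ∃ y ∈ C.Tops, C.Same x y := by
  obtain ⟨y, h1, h2⟩ := exists_le_covBy_of_lt (lt_r_hi (C := C) (x := x) (Fin.lt_def.2 (by omega)))
  have hs : C.Same x y := same_of_le h1 fun h => h2.lt.not_ge (r_le_iff.2 h)
  refine ⟨y, ⟨?_, ?_⟩, hs⟩
  · rwa [← hs.1, ← hs.2.1]
  · rwa [← hs.2.1]

theorem eq_of_same_of_mem_tops (hx : x ∈ C.Tops) (hy : y ∈ C.Tops) (h : C.Same x y) : x = y := by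
  have h1 := hx.2
  have h2 := hy.2
  rw [← h.2.1] at h2
  exact h.2.2.elim (eq_of_covBy_of_covBy_of_le h1 h2)
    fun h' => (eq_of_covBy_of_covBy_of_le h2 h1 h').symm

end Coord

theorem mem_posetIrr_of_orderIso {P Q : Type*} [PartialOrder P] [PartialOrder Q] (e : P ≃o Q)
    {x : P} (hx : x ∈ posetIrr P) : e x ∈ posetIrr Q := by
  refine ⟨fun y hy z hz => ?_, fun y hy z hz => ?_⟩
  · have hy : y ⋖ e x := hy
    have hz : z ⋖ e x := hz
    rw [← e.apply_symm_apply y, apply_covBy_apply_iff] at hy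
    rw [← e.apply_symm_apply z, apply_covBy_apply_iff] at hz
    exact e.symm.injective (hx.1 hy hz)
  · have hy : e x ⋖ y := hy
    have hz : e x ⋖ z := hz
    rw [← e.apply_symm_apply y, apply_covBy_apply_iff] at hy
    rw [← e.apply_symm_apply z, apply_covBy_apply_iff] at hz
    exact e.symm.injective (hx.2 hy hz)

theorem image_posetRed {P Q : Type*} [PartialOrder P] [PartialOrder Q] (e : P ≃o Q) :
    e '' posetRed P = posetRed Q := by
  ext y
  constructor
  · rintro ⟨x, hx, rfl⟩ hy
    exact hx (by simpa using mem_posetIrr_of_orderIso e.symm hy)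
  · intro hy
    refine ⟨e.symm y, fun h => hy ?_, e.apply_symm_apply y⟩
    simpa using mem_posetIrr_of_orderIso e h

namespace Coord

/-! ### Numbers of elements with given indices -/

section Count

variable {P Q : Type*} [PartialOrder P] [PartialOrder Q] (C : Coord P) (D : Coord Q)

/-- The pair of the indices of an element. -/
def pair (x : P) : Fin 5 × Fin 5 := (C.lo x, C.hi x)

/-- The number of elements with given indices. -/
noncomputable def count (p : Fin 5 × Fin 5) : ℕ := Nat.card {x // C.pair x = p}

/-- Elements with equal indices are comparable. -/
def PairTotal : Prop := ∀ x y, C.pair x = C.pair y → x ≤ y ∨ y ≤ x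

variable {C D}

theorem PairTotal.consecTotal (h : C.PairTotal) : C.ConsecTotal :=
  fun x y h1 h2 _ => h x y (Prod.ext h1 h2)

theorem PairTotal.same_iff (h : C.PairTotal) {x y : P} : C.Same x y ↔ C.pair x = C.pair y :=
  ⟨fun hs => Prod.ext hs.1 hs.2.1,
    fun hp => ⟨congrArg Prod.fst hp, congrArg Prod.snd hp, h x y hp⟩⟩

/-- Goodness identifies the `5`-chain with the reducible elements, so an isomorphism carries one
chain onto the other, in order, and the indices are read off from the order. -/
theorem count_eq_of_orderIso (hC : C.Good) (hD : D.Good) [Finite P] [Finite Q] (e : P ≃o Q) :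
    C.count = D.count := by
  have hr : (fun i => e (C.r i)) = D.r := by
    refine (StrictMono.range_inj (e.strictMono.comp C.r_strictMono) D.r_strictMono).1 ?_
    rw [← hD.posetRed_eq, Set.range_comp, ← hC.posetRed_eq, image_posetRed]
  have hr' : ∀ i, D.r i = e (C.r i) := fun i => (congrFun hr i).symm
  have hlo : ∀ x, D.lo (e x) = C.lo x := by
    intro x
    apply le_antisymm
    · rw [← r_le_iff, ← e.le_iff_le, ← hr', r_le_iff]
    · rw [← r_le_iff, hr', e.le_iff_le, r_le_iff]
  have hhi : ∀ x, D.hi (e x) = C.hi x := by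
    intro x
    apply le_antisymm
    · rw [← le_r_iff, hr', e.le_iff_le, le_r_iff]
    · rw [← le_r_iff, ← e.le_iff_le, ← hr', le_r_iff]
  funext p
  exact Nat.card_congr (e.toEquiv.subtypeEquiv fun x => by
    simp only [pair, RelIso.coe_fn_toEquiv, hlo, hhi])

theorem card_eq_sum_count [Finite P] : Nat.card P = ∑ p, C.count p := by
  rw [← Nat.card_congr (Equiv.sigmaFiberEquiv C.pair), Nat.card_sigma]
  rfl

theorem count_diag (i : Fin 5) : C.count (i, i) = 1 := by
  rw [count, Nat.card_eq_one_iff_unique]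
  refine ⟨⟨?_⟩, ⟨⟨C.r i, by simp [pair, C.lo_r, C.hi_r]⟩⟩⟩
  rintro ⟨x, hx⟩ ⟨y, hy⟩
  simp only [pair, Prod.mk.injEq] at hx hy
  rw [Subtype.mk.injEq, C.eq_r x (hx.1.trans hx.2.symm), C.eq_r y (hy.1.trans hy.2.symm), hx.1, hy.1]

theorem count_of_lt {i k : Fin 5} (h : k < i) : C.count (i, k) = 0 := by
  rw [count, Nat.card_eq_zero]
  left
  refine ⟨?_⟩
  rintro ⟨x, hx⟩
  simp only [pair, Prod.mk.injEq] at hx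
  have := C.lo_le_hi x
  rw [hx.1, hx.2] at this
  exact absurd h this.not_gt

end Count

/-! ### From coordinates to lattices -/

section Lattice

variable {P : Type*} [PartialOrder P] (C : Coord P) {x y z : P}

/-- An upper bound of two incomparable elements cannot lie on the hanging chain of either. So their
joins are members of the `5`-chain; the next lemma is the dual. -/
theorem hi_le_lo_of_not_le (hxy : ¬ x ≤ y) (hyx : ¬ y ≤ x) (hx : x ≤ z) (hy : y ≤ z) :
    C.hi x ≤ C.lo z := by
  by_contra h
  have h1 := same_of_le hx h
  by_cases h' : C.hi y ≤ C.lo z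
  · exact hyx (C.le_of (h1.1 ▸ h'))
  · exact (h1.trans (same_of_le hy h').symm).2.2.elim hxy hyx

theorem hi_le_lo_of_not_ge (hxy : ¬ x ≤ y) (hyx : ¬ y ≤ x) (hx : z ≤ x) (hy : z ≤ y) :
    C.hi z ≤ C.lo x := by
  by_contra h
  have h1 := same_of_le hx h
  by_cases h' : C.hi z ≤ C.lo y
  · exact hxy (C.le_of (h1.2.1 ▸ h'))
  · exact (h1.symm.trans (same_of_le hy h')).2.2.elim hxy hyx

open Classical in
/-- A poset with coordinates is a lattice. -/
@[reducible]
noncomputable def toLattice : Lattice P where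
  sup x y := if x ≤ y then y else if y ≤ x then x else C.r (max (C.hi x) (C.hi y))
  inf x y := if x ≤ y then x else if y ≤ x then y else C.r (min (C.lo x) (C.lo y))
  le_sup_left x y := by
    split_ifs with h1 h2
    · exact h1
    · exact le_rfl
    · exact le_r_iff.2 (le_max_left _ _)
  le_sup_right x y := by
    split_ifs with h1 h2
    · exact le_rfl
    · exact h2
    · exact le_r_iff.2 (le_max_right _ _)
  sup_le x y z hx hy := by
    split_ifs with h1 h2
    · exact hy
    · exact hx
    · exact r_le_iff.2 (max_le (C.hi_le_lo_of_not_le h1 h2 hx hy) (C.hi_le_lo_of_not_le h2 h1 hy hx))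
  inf_le_left x y := by
    split_ifs with h1 h2
    · exact le_rfl
    · exact h2
    · exact r_le_iff.2 (min_le_left _ _)
  inf_le_right x y := by
    split_ifs with h1 h2
    · exact h1
    · exact le_rfl
    · exact r_le_iff.2 (min_le_right _ _)
  le_inf z x y hx hy := by
    split_ifs with h1 h2
    · exact hx
    · exact hy
    · exact le_r_iff.2 (le_min (C.hi_le_lo_of_not_ge h1 h2 hx hy) (C.hi_le_lo_of_not_ge h2 h1 hy hx))

/-- A finite poset with coordinates is isomorphic to a lattice on `Fin j`. -/
theorem exists_finLattice (C : Coord P) [Finite P] {j : ℕ} (hj : Nat.card P = j) :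
    ∃ L : FinLattice j, Nonempty (P ≃o L.Carrier) := by
  obtain ⟨e⟩ : Nonempty (P ≃ Fin j) := ⟨(Finite.equivFin P).trans (finCongr hj)⟩
  let po : PartialOrder (Fin j) := PartialOrder.lift e.symm e.symm.injective
  let f : @OrderIso P (Fin j) _ po.toLE :=
    @RelIso.mk P (Fin j) (· ≤ ·) po.le e fun {a b} => by
      change e.symm (e a) ≤ e.symm (e b) ↔ a ≤ b
      simp
  exact ⟨⟨@toLattice (Fin j) po (@map P (Fin j) _ po C f)⟩, ⟨f⟩⟩

end Lattice

end Coord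

/-- The number of elements of the model with given indices. -/
def eff (G : Fin 5 × Fin 5 → ℕ) (p : Fin 5 × Fin 5) : ℕ :=
  if p.1 < p.2 then G p else if p.1 = p.2 then 1 else 0

/-- The poset that consists of a `5`-chain and of a chain with `G (i, k)` elements between its
members with the indices `i < k`. -/
@[ext]
structure Model (G : Fin 5 × Fin 5 → ℕ) where
  lo : Fin 5
  hi : Fin 5
  pos : ℕ
  pos_lt : pos < eff G (lo, hi)

namespace Model

variable {G : Fin 5 × Fin 5 → ℕ}

theorem lo_le_hi (x : Model G) : x.lo ≤ x.hi := by
  have h := x.pos_lt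
  by_contra h'
  rw [not_le] at h'
  simp [eff, h'.asymm, h'.ne'] at h

theorem pos_eq_zero (x : Model G) (h : x.lo = x.hi) : x.pos = 0 := by
  have h' := x.pos_lt
  simpa [eff, h] using h'

instance : PartialOrder (Model G) where
  le x y := x.hi ≤ y.lo ∨ (x.lo = y.lo ∧ x.hi = y.hi ∧ x.pos ≤ y.pos)
  le_refl x := Or.inr ⟨rfl, rfl, le_rfl⟩
  le_trans x y z := by
    have := y.lo_le_hi
    rintro (h1 | ⟨h1, h2, h3⟩) (h4 | ⟨h4, h5, h6⟩)
    · exact Or.inl (h1.trans (this.trans h4))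
    · exact Or.inl (h4 ▸ h1)
    · exact Or.inl (h2 ▸ h4)
    · exact Or.inr ⟨h1.trans h4, h2.trans h5, h3.trans h6⟩
  le_antisymm x y := by
    have hx := x.lo_le_hi
    have hy := y.lo_le_hi
    have key : x.hi ≤ y.lo → y.hi ≤ x.lo → x = y := by
      intro h1 h2
      have e1 : x.lo = x.hi := le_antisymm hx (h1.trans (hy.trans h2))
      have e2 : y.lo = y.hi := le_antisymm hy (h2.trans (hx.trans h1))
      have e3 : x.lo = y.lo := le_antisymm (hx.trans h1) (hy.trans h2)
      exact Model.ext e3 (e1.symm.trans (e3.trans e2))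
        ((x.pos_eq_zero e1).trans (y.pos_eq_zero e2).symm)
    rintro (h1 | ⟨h1, h2, h3⟩) (h4 | ⟨h4, h5, h6⟩)
    · exact key h1 h4
    · exact key h1 (by rw [h5, ← h4]; exact h1)
    · exact key (by rw [h2, ← h1]; exact h4) h4
    · exact Model.ext h1 h2 (le_antisymm h3 h6)

/-- The coordinates of the model. -/
@[simps]
def coord (G : Fin 5 × Fin 5 → ℕ) : Coord (Model G) where
  r i := ⟨i, i, 0, by simp [eff]⟩
  lo := lo
  hi := hi
  lo_r _ := rfl
  hi_r _ := rfl
  lo_le_hi := lo_le_hi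
  eq_r x h := Model.ext rfl h.symm (x.pos_eq_zero h)
  le_of := Or.inl
  of_le h := h.imp_right fun h => ⟨h.1, h.2.1⟩
  up_total {x y z} h1 h2 h3 h4 _ _ := (le_total x.pos y.pos).imp
    (fun h => Or.inr ⟨h1.trans h3.symm, h2.trans h4.symm, h⟩)
    (fun h => Or.inr ⟨h3.trans h1.symm, h4.trans h2.symm, h⟩)
  down_total {x y z} h1 h2 h3 h4 _ _ := (le_total x.pos y.pos).imp
    (fun h => Or.inr ⟨h1.trans h3.symm, h2.trans h4.symm, h⟩)
    (fun h => Or.inr ⟨h3.trans h1.symm, h4.trans h2.symm, h⟩)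

theorem pairTotal_coord : (coord G).PairTotal := by
  intro x y h
  have h1 : x.lo = y.lo := congrArg Prod.fst h
  have h2 : x.hi = y.hi := congrArg Prod.snd h
  exact (le_total x.pos y.pos).imp (fun h => Or.inr ⟨h1, h2, h⟩)
    (fun h => Or.inr ⟨h1.symm, h2.symm, h⟩)

/-- The elements with given indices, enumerated. -/
def fiberEquiv (p : Fin 5 × Fin 5) : {x // (coord G).pair x = p} ≃ Fin (eff G p) where
  toFun x := ⟨x.1.pos, by
    obtain ⟨x, rfl⟩ := x
    exact x.pos_lt⟩
  invFun n := ⟨⟨p.1, p.2, n, n.2⟩, rfl⟩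
  left_inv := by
    rintro ⟨x, rfl⟩
    rfl
  right_inv _ := rfl

theorem count_coord : (coord G).count = eff G := by
  funext p
  rw [Coord.count, Nat.card_congr (fiberEquiv p), Nat.card_fin]

instance : Finite (Model G) :=
  Finite.of_equiv _ ((Equiv.sigmaCongrRight fiberEquiv).symm.trans
    (Equiv.sigmaFiberEquiv (coord G).pair))

theorem card_eq : Nat.card (Model G) = ∑ p, eff G p := by
  rw [(coord G).card_eq_sum_count, count_coord]

end Model

namespace Coord

variable {P Q : Type*} [PartialOrder P] [PartialOrder Q]
  {C : Coord P} {D : Coord Q}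

theorem eff_count : eff C.count = C.count := by
  funext ⟨i, k⟩
  rw [eff]
  split_ifs with h1 h2
  · rfl
  · obtain rfl : i = k := h2
    rw [count_diag]
  · rw [count_of_lt]
    exact lt_of_le_of_ne (not_lt.1 h1) fun h => h2 h.symm

variable [Finite P] [Finite Q]

/-- The number of elements below `x` with the same indices. -/
noncomputable def rank (C : Coord P) (x : P) : ℕ := {y | C.pair y = C.pair x ∧ y < x}.ncard

theorem rank_lt (C : Coord P) (x : P) : C.rank x < C.count (C.pair x) := by
  have : C.count (C.pair x) = {y | C.pair y = C.pair x}.ncard := rfl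
  rw [this]
  refine Set.ncard_lt_ncard ⟨fun y hy => hy.1, fun h => ?_⟩
  exact lt_irrefl x (h (rfl : C.pair x = C.pair x)).2

theorem rank_lt_rank {x y : P} (h : C.pair x = C.pair y) (hxy : x < y) : C.rank x < C.rank y := by
  refine Set.ncard_lt_ncard ⟨fun z hz => ⟨hz.1.trans h, hz.2.trans hxy⟩, fun h' => ?_⟩
  exact lt_irrefl x (h' ⟨h, hxy⟩).2

/-- Indices together with the rank inside the hanging chain embed the order into the model, and an
embedding between finite sets of equal size is onto. -/
theorem PairTotal.nonempty_orderIso_model (hC : C.PairTotal) :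
    Nonempty (P ≃o Model C.count) := by
  let f : P → Model C.count := fun x =>
    ⟨C.lo x, C.hi x, C.rank x, by rw [eff_count]; exact C.rank_lt x⟩
  have hf : ∀ {x y}, f x ≤ f y ↔ x ≤ y := by
    intro x y
    constructor
    · rintro (h | ⟨h1, h2, h3⟩)
      · exact C.le_of h
      · have hp : C.pair x = C.pair y := Prod.ext h1 h2
        rcases hC x y hp with h | h
        · exact h
        · rcases h.eq_or_lt with h | h
          · exact h.ge
          · exact absurd (rank_lt_rank hp.symm h) (not_lt.2 h3)
    · intro h
      rcases C.of_le h with h' | ⟨h1, h2⟩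
      · exact Or.inl h'
      · refine Or.inr ⟨h1, h2, ?_⟩
        rcases h.eq_or_lt with rfl | h
        · exact le_rfl
        · exact (rank_lt_rank (Prod.ext h1 h2) h).le
  let g : P ↪o Model C.count := OrderEmbedding.ofMapLEIff f fun _ _ => hf
  have hg : Function.Bijective g := by
    rw [Nat.bijective_iff_injective_and_card]
    refine ⟨g.injective, ?_⟩
    rw [Model.card_eq, eff_count, C.card_eq_sum_count]
  exact ⟨⟨Equiv.ofBijective g hg, g.le_iff_le⟩⟩

theorem PairTotal.nonempty_orderIso_of_count_eq (hC : C.PairTotal) (hD : D.PairTotal)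
    (h : C.count = D.count) : Nonempty (P ≃o Q) := by
  obtain ⟨e⟩ := hC.nonempty_orderIso_model
  obtain ⟨f⟩ := hD.nonempty_orderIso_model
  rw [h] at e
  exact ⟨e.trans f.symm⟩

end Coord

namespace Coord

variable {P : Type*} [PartialOrder P] {C : Coord P} {i : Fin 5} {y z : P}

/-- Of the two covers, the one with the larger upper index is essential, the other being its
witness. It is off the `5`-chain, as otherwise it would lie above the other cover. -/
theorem exists_ess_of_two_upper_covers (hy : C.r i ⋖ y) (hz : C.r i ⋖ z) (hne : y ≠ z) :
    ∃ x, C.Ess x ∧ C.lo x = i := by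
  wlog h : C.hi z ≤ C.hi y generalizing y z
  · exact this hz hy hne.symm (le_of_not_ge h)
  have h1 : ¬ y ≤ z := fun h => hne (eq_of_covBy_of_covBy_of_le_up hy hz h)
  have h2 : ¬ z ≤ y := fun h => hne (eq_of_covBy_of_covBy_of_le_up hz hy h).symm
  have hiy : i ≤ C.lo y := r_le_iff.1 hy.le
  have hiz : i ≤ C.lo z := r_le_iff.1 hz.le
  have hlo : C.lo y = i := by
    rcases hy.eq_or_eq (r_le_r.2 hiy) (C.r_lo_le y) with e | e
    · exact C.r_strictMono.injective e
    · have : C.hi y = C.lo y := by conv_lhs => rw [← e, C.hi_r]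
      exact absurd (C.le_of (this ▸ h)) h2
  exact ⟨y, ⟨z, h1, h2, hlo ▸ hiz, h⟩, hlo⟩

theorem exists_ess_of_two_lower_covers (hy : y ⋖ C.r i) (hz : z ⋖ C.r i) (hne : y ≠ z) :
    ∃ x, C.Ess x ∧ C.hi x = i := by
  wlog h : C.lo y ≤ C.lo z generalizing y z
  · exact this hz hy hne.symm (le_of_not_ge h)
  have h1 : ¬ y ≤ z := fun h => hne (eq_of_covBy_of_covBy_of_le hy hz h)
  have h2 : ¬ z ≤ y := fun h => hne (eq_of_covBy_of_covBy_of_le hz hy h).symm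
  have hiy : C.hi y ≤ i := le_r_iff.1 hy.le
  have hiz : C.hi z ≤ i := le_r_iff.1 hz.le
  have hhi : C.hi y = i := by
    rcases hy.eq_or_eq (C.le_r_hi y) (r_le_r.2 hiy) with e | e
    · have : C.lo y = C.hi y := by conv_lhs => rw [← e, C.lo_r]
      exact absurd (C.le_of (this ▸ h)) h1
    · exact C.r_strictMono.injective e
  exact ⟨y, ⟨z, h1, h2, h, hhi ▸ hiz⟩, hhi⟩

theorem good_of_range_subset_posetRed (h : Set.range C.r ⊆ posetRed P) : C.Good := by
  intro i
  have hi := h ⟨i, rfl⟩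
  by_contra hc
  push Not at hc
  refine hi ⟨fun y hy z hz => ?_, fun y hy z hz => ?_⟩ <;> by_contra hne
  · obtain ⟨x, hx, hxi⟩ := exists_ess_of_two_lower_covers hy hz hne
    exact (hc x hx).2 hxi
  · obtain ⟨x, hx, hxi⟩ := exists_ess_of_two_upper_covers hy hz hne
    exact (hc x hx).1 hxi

end Coord

/-! ### From blocks to coordinates -/

section Lattice

variable {L : Type*} [Lattice L]

theorem red_eq_posetRed [Finite L] : Red L = posetRed L := by
  ext x
  constructor
  · rintro (⟨y, z, hy, hz, rfl⟩ | ⟨y, z, hy, hz, rfl⟩) hirr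
    · obtain ⟨y', hyy, hy'⟩ := exists_le_covBy_of_lt (lt_of_le_of_ne le_sup_left hy)
      obtain ⟨z', hzz, hz'⟩ := exists_le_covBy_of_lt (lt_of_le_of_ne le_sup_right hz)
      obtain rfl : y' = z' := hirr.1 hy' hz'
      exact hy'.lt.not_ge (sup_le hyy hzz)
    · obtain ⟨y', hy', hyy⟩ := exists_covBy_le_of_lt (lt_of_le_of_ne inf_le_left hy.symm)
      obtain ⟨z', hz', hzz⟩ := exists_covBy_le_of_lt (lt_of_le_of_ne inf_le_right hz.symm)
      obtain rfl : y' = z' := hirr.2 hy' hz'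
      exact hy'.lt.not_ge (le_inf hyy hzz)
  · intro h
    by_contra hx
    refine h ⟨fun y hy z hz => ?_, fun y hy z hz => ?_⟩ <;> by_contra hne
    · exact hx (Or.inl ⟨y, z, CovBy.ne hy, CovBy.ne hz, (CovBy.wcovBy hy).sup_eq (CovBy.wcovBy hz) hne⟩)
    · exact hx (Or.inr ⟨y, z, CovBy.ne' hy, CovBy.ne' hz, (CovBy.wcovBy hy).inf_eq (CovBy.wcovBy hz) hne⟩)

theorem exists_index_chain [Finite L] (hcard : (Red L).ncard = 5)
    (hchain : IsChain (· ≤ ·) (Red L)) :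
    ∃ r : Fin 5 → L, StrictMono r ∧ Set.range r = Red L := by
  classical
  let _ : LinearOrder (Red L) :=
    { (inferInstance : PartialOrder (Red L)) with
      le_total := fun x y => hchain.total x.2 y.2
      toDecidableLE := Classical.decRel _ }
  have := Fintype.ofFinite (Red L)
  have hc : Fintype.card (Red L) = 5 := by
    rw [← Nat.card_eq_fintype_card]
    exact hcard
  let e := monoEquivOfFin (Red L) hc
  refine ⟨fun i => e i, fun i k h => e.strictMono h, ?_⟩
  ext x
  constructor
  · rintro ⟨i, rfl⟩
    exact (e i).2
  · intro hx
    exact ⟨e.symm ⟨x, hx⟩, by simp⟩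

/-- Every axiom of `Coord` that does not follow from monotonicity comes from one fact: joins and
meets of incomparable elements are reducible, hence in the range of `r`. -/
theorem exists_coord [Finite L] (hcard : (Red L).ncard = 5) (hchain : IsChain (· ≤ ·) (Red L))
    (hblock : IsBlock L) : ∃ C : Coord L, C.Good := by
  obtain ⟨r, hr, hrange⟩ := exists_index_chain hcard hchain
  obtain ⟨⟨b, hb, hbot⟩, ⟨t, ht, htop⟩⟩ := hblock
  rw [← hrange] at hb ht
  obtain ⟨b, rfl⟩ := hb
  obtain ⟨t, rfl⟩ := ht
  have hlo : ∀ x, ∃ l, ∀ i, r i ≤ x ↔ i ≤ l := by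
    intro x
    obtain ⟨l, hl, hmax⟩ := Set.exists_max_image {i | r i ≤ x} id (Set.toFinite _) ⟨b, hbot x⟩
    exact ⟨l, fun i => ⟨hmax i, fun h => (hr.monotone h).trans hl⟩⟩
  have hhi : ∀ x, ∃ l, ∀ i, x ≤ r i ↔ l ≤ i := by
    intro x
    obtain ⟨l, hl, hmin⟩ := Set.exists_min_image {i | x ≤ r i} id (Set.toFinite _) ⟨t, htop x⟩
    exact ⟨l, fun i => ⟨hmin i, fun h => le_trans hl (hr.monotone h)⟩⟩
  choose lo hlo using hlo
  choose hi hhi using hhi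
  have hle : ∀ x, r (lo x) ≤ x := fun x => (hlo x _).2 le_rfl
  have hge : ∀ x, x ≤ r (hi x) := fun x => (hhi x _).2 le_rfl
  have hsup : ∀ x y, ¬ x ≤ y → ¬ y ≤ x → ∃ i, r i = x ⊔ y := by
    intro x y h1 h2
    have : x ⊔ y ∈ Red L := Or.inl ⟨x, y, fun h => h2 (sup_eq_left.1 h.symm),
      fun h => h1 (sup_eq_right.1 h.symm), rfl⟩
    rwa [← hrange] at this
  have hinf : ∀ x y, ¬ x ≤ y → ¬ y ≤ x → ∃ i, r i = x ⊓ y := by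
    intro x y h1 h2
    have : x ⊓ y ∈ Red L := Or.inr ⟨x, y, fun h => h1 (inf_eq_left.1 h.symm),
      fun h => h2 (inf_eq_right.1 h.symm), rfl⟩
    rwa [← hrange] at this
  let C : Coord L :=
    { r := r
      lo := lo
      hi := hi
      lo_r := fun i => le_antisymm (hr.le_iff_le.1 (hle _)) ((hlo _ _).1 le_rfl)
      hi_r := fun i => le_antisymm ((hhi _ _).1 le_rfl) (hr.le_iff_le.1 (hge _))
      lo_le_hi := fun x => hr.le_iff_le.1 ((hle x).trans (hge x))
      eq_r := fun x h => le_antisymm (h ▸ hge x) (hle x)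
      le_of := fun {x y} h => (hge x).trans ((hr.monotone h).trans (hle y))
      of_le := by
        intro x y hxy
        by_cases h : hi x ≤ lo y
        · exact Or.inl h
        refine Or.inr ⟨le_antisymm ((hlo _ _).1 ((hle x).trans hxy)) ?_,
          le_antisymm ((hhi _ _).1 (hxy.trans (hge y))) ?_⟩
        · by_contra h1
          -- If `r (lo y)` were not below `x`, the join of the two would be a member of the chain
          -- between `x` and `y`, contrary to `h`.
          obtain ⟨i, hi⟩ := hsup x (r (lo y)) (fun h' => h ((hhi _ _).1 h'))
            (fun h' => h1 ((hlo _ _).1 h'))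
          exact h (((hhi _ _).1 (hi ▸ le_sup_left)).trans
            ((hlo _ _).1 (hi ▸ sup_le hxy (hle y))))
        · by_contra h1
          obtain ⟨i, hi⟩ := hinf y (r (hi x)) (fun h' => h1 ((hhi _ _).1 h'))
            (fun h' => h ((hlo _ _).1 h'))
          exact h (((hhi _ _).1 (hi ▸ le_inf hxy (hge x))).trans
            ((hlo _ _).1 (hi ▸ inf_le_left)))
      up_total := by
        intro x y z h1 h2 h3 h4 h5 h6
        by_contra h
        rw [not_or] at h
        obtain ⟨i, hi⟩ := hsup x y h.1 h.2
        have h7 : i ≤ lo z := (hlo _ _).1 (hi ▸ sup_le h5 h6)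
        rw [← h1, ← hlo, hi] at h7
        exact h.2 (le_sup_right.trans h7)
      down_total := by
        intro x y z h1 h2 h3 h4 h5 h6
        by_contra h
        rw [not_or] at h
        obtain ⟨i, hi⟩ := hinf x y h.1 h.2
        have h7 := (hhi _ _).1 (hi ▸ le_inf h5 h6)
        rw [← h2, ← hhi, hi] at h7
        exact h.1 (h7.trans inf_le_right) }
  exact ⟨C, Coord.good_of_range_subset_posetRed (hrange.trans red_eq_posetRed).le⟩

theorem isBlockOfType_of_coord [Finite L] {C : Coord L} (hC : C.Good) (hC' : C.ConsecTotal)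
    {k : ℕ} (hk : C.Tops.ncard = k) : IsBlockOfType L 5 k := by
  have hred : Red L = Set.range C.r := red_eq_posetRed.trans hC.posetRed_eq
  refine ⟨⟨⟨C.r 0, ?_, C.isBot_r_zero⟩, ⟨C.r 4, ?_, C.isTop_r_last⟩⟩, ?_, ?_, ?_⟩
  · exact hred ▸ ⟨0, rfl⟩
  · exact hred ▸ ⟨4, rfl⟩
  · rw [hred, Set.ncard_range_of_injective C.r_strictMono.injective, Nat.card_fin]
  · rw [hred]
    exact C.r_strictMono.monotone.isChain_range
  · rw [Coord.nullity_eq_ncard_tops hC', hk]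

end Lattice

/-! ### Supports -/

/-- The pairs of members of the `5`-chain to which the basic blocks `B₁, …, B₇` have an element
adjoined. -/
def supp : Fin 7 → Finset (Fin 5 × Fin 5) :=
  ![{(0, 2), (1, 3), (1, 4)}, {(2, 4), (1, 3), (0, 3)}, {(0, 2), (1, 3), (0, 4)},
    {(2, 4), (1, 3), (0, 4)}, {(0, 2), (1, 3), (2, 4)}, {(0, 3), (1, 4), (2, 4)},
    {(1, 4), (0, 3), (0, 2)}]

/-- The pairs of nonconsecutive indices. -/
def farPairs : Finset (Fin 5 × Fin 5) := {(0, 2), (0, 3), (0, 4), (1, 3), (1, 4), (2, 4)}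

theorem mem_farPairs {p : Fin 5 × Fin 5} : p ∈ farPairs ↔ (p.1 : ℕ) + 1 < p.2 := by
  revert p
  decide

theorem supp_subset_farPairs (i : Fin 7) : supp i ⊆ farPairs := by
  revert i
  decide

theorem card_supp (i : Fin 7) : (supp i).card = 3 := by
  revert i
  decide

theorem supp_injective : Function.Injective supp := by
  decide

theorem exists_mem_supp (i : Fin 7) (k : Fin 5) : ∃ p ∈ supp i, p.1 = k ∨ p.2 = k := by
  revert i k
  decide

/-- Membership in the supports, as a table. -/
def suppTable : Fin 7 → List Bool :=
  ![[true, false, false, true, true, false], [false, true, false, true, false, true],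
    [true, false, true, true, false, false], [false, false, true, true, false, true],
    [true, false, false, true, false, true], [false, true, false, false, true, true],
    [true, true, false, false, true, false]]

theorem suppTable_eq (i : Fin 7) : suppTable i = [decide ((0, 2) ∈ supp i),
    decide ((0, 3) ∈ supp i), decide ((0, 4) ∈ supp i), decide ((1, 3) ∈ supp i),
    decide ((1, 4) ∈ supp i), decide ((2, 4) ∈ supp i)] := by
  revert i
  decide

/-- The booleans stand for the pairs `(0, 2)`, `(0, 3)`, `(0, 4)`, `(1, 3)`, `(1, 4)`, `(2, 4)`, and
the five clauses say in turn that `0`, …, `4` is an end of a chosen pair. With booleans in place of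
a finset only 64 cases have to be decided. -/
theorem exists_eq_suppTable : ∀ a b c d e f : Bool,
    a.toNat + b.toNat + c.toNat + d.toNat + e.toNat + f.toNat ≤ 3 →
      ((a || b || c) && (d || e) && (a || f) && (b || d) && (c || e || f)) = true →
      ∃ i : Fin 7, [a, b, c, d, e, f] = suppTable i := by
  decide

theorem exists_eq_supp {s : Finset (Fin 5 × Fin 5)} (hs : s ⊆ farPairs) (hcard : s.card ≤ 3)
    (hcover : ∀ k : Fin 5, ∃ p ∈ s, p.1 = k ∨ p.2 = k) : ∃ i, s = supp i := by
  have hcover' : ∀ k : Fin 5, ∃ p ∈ farPairs, p ∈ s ∧ (p.1 = k ∨ p.2 = k) := fun k =>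
    let ⟨p, hp, hk⟩ := hcover k
    ⟨p, hs hp, hp, hk⟩
  have hcard' : (farPairs.filter (· ∈ s)).card ≤ 3 := by
    rwa [Finset.filter_mem_eq_inter, Finset.inter_eq_right.2 hs]
  rw [Finset.card_filter] at hcard'
  have h0 := hcover' 0
  have h1 := hcover' 1
  have h2 := hcover' 2
  have h3 := hcover' 3
  have h4 := hcover' 4
  simp [farPairs] at h0 h1 h2 h3 h4
  rw [farPairs, Finset.sum_insert (by decide), Finset.sum_insert (by decide),
    Finset.sum_insert (by decide), Finset.sum_insert (by decide), Finset.sum_insert (by decide),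
    Finset.sum_singleton] at hcard'
  obtain ⟨i, hi⟩ := exists_eq_suppTable (decide ((0, 2) ∈ s)) (decide ((0, 3) ∈ s))
    (decide ((0, 4) ∈ s)) (decide ((1, 3) ∈ s)) (decide ((1, 4) ∈ s)) (decide ((2, 4) ∈ s))
    (by simp only [Bool.toNat, Bool.cond_decide]; omega)
    (by simp only [Bool.and_eq_true, Bool.or_eq_true, decide_eq_true_eq, or_assoc]; exact ⟨⟨⟨⟨h0, h1⟩, h2⟩, h3⟩, h4⟩)
  have hmem : ∀ p ∈ farPairs, p ∈ s ↔ p ∈ supp i := by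
    simp only [farPairs, Finset.forall_mem_insert, Finset.mem_singleton, forall_eq]
    simp only [← decide_eq_decide]
    rw [suppTable_eq] at hi
    simpa only [List.cons.injEq, and_true] using hi
  exact ⟨i, Finset.ext fun p => ⟨fun hp => (hmem p (hs hp)).1 hp,
    fun hp => (hmem p (supp_subset_farPairs i hp)).2 hp⟩⟩

/-- The numbers of elements with given indices in a basic block. -/
def base (i : Fin 7) (p : Fin 5 × Fin 5) : ℕ := if p.1 = p.2 ∨ p ∈ supp i then 1 else 0

/-- The pairs of indices with an unrestricted number of further elements. -/
def slots (i : Fin 7) : Finset (Fin 5 × Fin 5) := {(0, 1), (1, 2), (2, 3), (3, 4)} ∪ supp i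

theorem sum_base (i : Fin 7) : ∑ p, base i p = 8 := by
  revert i
  decide

theorem mem_nearPairs : ∀ {p : Fin 5 × Fin 5},
    p ∈ ({(0, 1), (1, 2), (2, 3), (3, 4)} : Finset (Fin 5 × Fin 5)) ↔ (p.1 : ℕ) + 1 = p.2 := by
  decide

theorem mem_slots {i : Fin 7} {p : Fin 5 × Fin 5} :
    p ∈ slots i ↔ (p.1 : ℕ) + 1 = p.2 ∨ p ∈ supp i := by
  rw [slots, Finset.mem_union, mem_nearPairs]

theorem card_slots (i : Fin 7) : (slots i).card = 7 := by
  revert i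
  decide

/-- The numbers of elements with given indices in the blocks on `j` elements with a given basic
block. -/
def family (j : ℕ) (i : Fin 7) : Finset (Fin 5 × Fin 5 → ℕ) :=
  ((slots i).piAntidiag (j - 8)).map (addLeftEmbedding (base i))

theorem card_piAntidiag {ι : Type*} [DecidableEq ι] (s : Finset ι) (n : ℕ) :
    (s.piAntidiag n).card = s.card.multichoose n := by
  rw [← Finset.card_finsuppAntidiag_nat_eq_multichoose, Finset.finsuppAntidiag, Finset.card_map,
    Finset.card_attach]

/-- Stars and bars: `j - 8` elements into seven slots, the eight elements of the basic block being
fixed. -/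
theorem card_family {j : ℕ} (hj : 8 ≤ j) (i : Fin 7) : (family j i).card = (j - 2).choose 6 := by
  rw [family, Finset.card_map, card_piAntidiag, card_slots, Nat.multichoose_eq,
    show 7 + (j - 8) - 1 = j - 2 by omega]
  exact Nat.choose_symm_of_eq_add (by omega)

theorem mem_family {j : ℕ} (hj : 8 ≤ j) {i : Fin 7} {G : Fin 5 × Fin 5 → ℕ} :
    G ∈ family j i ↔ ∑ p, G p = j ∧ (∀ p, base i p ≤ G p) ∧ ∀ p ∉ slots i, G p = base i p := by
  rw [family, Finset.mem_map]
  constructor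
  · rintro ⟨g, hg, rfl⟩
    obtain ⟨h1, h2⟩ := Finset.mem_piAntidiag.1 hg
    have h3 : ∑ p, g p = (slots i).sum g :=
      (Finset.sum_subset (Finset.subset_univ _) fun p _ hp => by_contra fun h => hp (h2 p h)).symm
    refine ⟨?_, fun p => Nat.le_add_right _ _, fun p hp => ?_⟩
    · simp only [addLeftEmbedding_apply, Pi.add_apply, Finset.sum_add_distrib, sum_base, h3, h1]
      omega
    · have : g p = 0 := by_contra fun h => hp (h2 p h)
      simp [this]
  · rintro ⟨h1, h2, h3⟩
    refine ⟨fun p => G p - base i p, Finset.mem_piAntidiag.2 ⟨?_, ?_⟩, ?_⟩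
    · rw [Finset.sum_subset (Finset.subset_univ _) fun p _ hp => by rw [h3 p hp, Nat.sub_self],
        Finset.sum_tsub_distrib _ fun p _ => h2 p, h1, sum_base]
    · intro p hp
      by_contra h
      exact hp (by rw [h3 p h, Nat.sub_self])
    · funext p
      exact Nat.add_sub_cancel' (h2 p)

section Family

variable {j : ℕ} {i : Fin 7} {G : Fin 5 × Fin 5 → ℕ}

theorem ne_zero_iff_of_mem_family (hj : 8 ≤ j) (hG : G ∈ family j i) {p : Fin 5 × Fin 5}
    (hp : p ∈ farPairs) : G p ≠ 0 ↔ p ∈ supp i := by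
  obtain ⟨-, h1, h2⟩ := (mem_family hj).1 hG
  rw [mem_farPairs] at hp
  constructor
  · intro h
    by_contra hs
    refine h ?_
    rw [h2 p, base, if_neg]
    · rintro (h' | h')
      · rw [h'] at hp
        omega
      · exact hs h'
    · rw [mem_slots]
      rintro (h' | h')
      · omega
      · exact hs h'
  · intro h
    have := h1 p
    rw [base, if_pos (Or.inr h)] at this
    omega

theorem eff_eq_of_mem_family (hj : 8 ≤ j) (hG : G ∈ family j i) : eff G = G := by
  obtain ⟨-, -, h2⟩ := (mem_family hj).1 hG
  funext p
  have hp : ∀ q ∈ supp i, (q.1 : ℕ) + 1 < q.2 := fun q hq =>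
    mem_farPairs.1 (supp_subset_farPairs i hq)
  rw [eff]
  split_ifs with h h'
  · rfl
  all_goals
    rw [Fin.lt_def] at h
    have hs : p ∉ supp i := fun hs => by have := hp p hs; omega
    have hs' : p ∉ slots i := by
      rw [mem_slots]
      rintro (h1 | h1)
      · omega
      · exact hs h1
    rw [h2 p hs', base]
  · rw [if_pos (Or.inl h')]
  · rw [if_neg (not_or.2 ⟨h', hs⟩)]

theorem eq_of_mem_family (hj : 8 ≤ j) {i' : Fin 7} (hG : G ∈ family j i) (hG' : G ∈ family j i') :
    i = i' := by
  refine supp_injective (Finset.ext fun p => ?_)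
  constructor <;> intro hp
  · exact (ne_zero_iff_of_mem_family hj hG' (supp_subset_farPairs _ hp)).1
      ((ne_zero_iff_of_mem_family hj hG (supp_subset_farPairs _ hp)).2 hp)
  · exact (ne_zero_iff_of_mem_family hj hG (supp_subset_farPairs _ hp)).1
      ((ne_zero_iff_of_mem_family hj hG' (supp_subset_farPairs _ hp)).2 hp)

end Family

/-! ### The counts that occur in blocks of nullity three -/

namespace Coord

variable {P : Type*} [PartialOrder P] {C : Coord P}

theorem setOf_farPairs_count {j : ℕ} {i : Fin 7} (hj : 8 ≤ j) (h : C.count ∈ family j i) :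
    {p | p ∈ farPairs ∧ C.count p ≠ 0} = (supp i : Set (Fin 5 × Fin 5)) := by
  ext p
  constructor
  · rintro ⟨h1, h2⟩
    exact (ne_zero_iff_of_mem_family hj h h1).1 h2
  · intro hp
    have h1 := supp_subset_farPairs i hp
    exact ⟨h1, (ne_zero_iff_of_mem_family hj h h1).2 hp⟩

variable [Finite P]

theorem count_ne_zero_iff {p : Fin 5 × Fin 5} : C.count p ≠ 0 ↔ ∃ x, C.pair x = p := by
  rw [count, ← Nat.pos_iff_ne_zero, Nat.card_pos_iff]
  simp [nonempty_subtype, Subtype.finite]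

theorem image_pair_tops (C : Coord P) : C.pair '' C.Tops = {p | p ∈ farPairs ∧ C.count p ≠ 0} := by
  ext p
  simp only [Set.mem_image, Set.mem_ofPred_eq, count_ne_zero_iff, mem_farPairs]
  constructor
  · rintro ⟨x, hx, rfl⟩
    exact ⟨hx.1, x, rfl⟩
  · rintro ⟨h, x, rfl⟩
    obtain ⟨y, hy, hs⟩ := exists_same_mem_tops h
    exact ⟨y, hy, Prod.ext hs.1.symm hs.2.1.symm⟩

theorem PairTotal.ncard_tops (hC : C.PairTotal) :
    C.Tops.ncard = {p | p ∈ farPairs ∧ C.count p ≠ 0}.ncard := by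
  rw [← image_pair_tops, Set.InjOn.ncard_image]
  intro x hx y hy h
  exact eq_of_same_of_mem_tops hx hy (hC.same_iff.2 h)

section

variable {j : ℕ} {i : Fin 7}

theorem good_of_count_mem_family (hj : 8 ≤ j) (h : C.count ∈ family j i) : C.Good := by
  intro k
  obtain ⟨p, hp, hk⟩ := exists_mem_supp i k
  have h1 := supp_subset_farPairs i hp
  obtain ⟨x, rfl⟩ := count_ne_zero_iff.1 ((ne_zero_iff_of_mem_family hj h h1).2 hp)
  exact ⟨x, ess_of_lo_add_one_lt_hi (mem_farPairs.1 h1), hk⟩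

theorem PairTotal.ncard_tops_of_count_mem_family (hC : C.PairTotal) (hj : 8 ≤ j)
    (h : C.count ∈ family j i) : C.Tops.ncard = 3 := by
  rw [hC.ncard_tops, setOf_farPairs_count hj h, Set.ncard_coe_finset, card_supp]

theorem count_mem_family (hj : 8 ≤ j) (hcard : Nat.card P = j)
    (h : {p | p ∈ farPairs ∧ C.count p ≠ 0} = (supp i : Set (Fin 5 × Fin 5))) :
    C.count ∈ family j i := by
  have hs : ∀ p, p ∈ farPairs ∧ C.count p ≠ 0 ↔ p ∈ supp i := fun p => Set.ext_iff.1 h p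
  rw [mem_family hj]
  refine ⟨by rw [← card_eq_sum_count, hcard], fun p => ?_, fun p hp => ?_⟩
  · rw [base]
    split_ifs with h1
    · rcases h1 with h1 | h1
      · obtain ⟨a, b⟩ := p
        obtain rfl : a = b := h1
        rw [count_diag]
      · exact Nat.one_le_iff_ne_zero.2 ((hs p).2 h1).2
    · exact Nat.zero_le _
  · rw [mem_slots, not_or] at hp
    obtain ⟨a, b⟩ := p
    dsimp only at hp
    rw [base]
    split_ifs with h1
    · obtain rfl : a = b := h1.resolve_right hp.2
      rw [count_diag]
    · rw [not_or] at h1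
      rcases lt_or_gt_of_ne h1.1 with h2 | h2
      · by_contra h3
        dsimp only at h2
        rw [Fin.lt_def] at h2
        exact hp.2 ((hs _).1 ⟨mem_farPairs.2 (by dsimp only; omega), h3⟩)
      · exact count_of_lt h2

end

/-- The pairs of the three tops are at most three and involve every index, so they form some `supp
i`. As this has three elements, distinct tops have distinct pairs, and no two far hanging chains are
parallel. -/
theorem exists_pairTotal_count_mem_family (hC : C.Good) (hC' : C.ConsecTotal) {j : ℕ} (hj : 8 ≤ j)
    (hcard : Nat.card P = j) (h3 : C.Tops.ncard = 3) :
    C.PairTotal ∧ ∃ i, C.count ∈ family j i := by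
  classical
  set s : Finset (Fin 5 × Fin 5) := farPairs.filter fun p => C.count p ≠ 0 with hs
  have hs' : C.pair '' C.Tops = s := by
    rw [image_pair_tops, hs, Finset.coe_filter]
  have hle : s.card ≤ 3 := by
    rw [← h3, ← Set.ncard_coe_finset, ← hs']
    exact Set.ncard_image_le (Set.toFinite _)
  obtain ⟨i, hi⟩ := exists_eq_supp (Finset.filter_subset _ _ : s ⊆ farPairs) hle (by
    intro k
    obtain ⟨x, hx, hk⟩ := hC k
    refine ⟨C.pair x, Finset.mem_filter.2 ⟨mem_farPairs.2 (hx.lo_add_one_lt_hi hC'), ?_⟩, hk⟩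
    exact count_ne_zero_iff.2 ⟨x, rfl⟩)
  have hinj : Set.InjOn C.pair C.Tops := by
    rw [← Set.ncard_image_iff, hs', Set.ncard_coe_finset, h3, hs, hi, card_supp]
  refine ⟨fun x y hxy => ?_, i, count_mem_family hj hcard ?_⟩
  · have h1 : C.lo x = C.lo y := congrArg Prod.fst hxy
    have h2 : C.hi x = C.hi y := congrArg Prod.snd hxy
    have h4 := Fin.le_def.1 (C.lo_le_hi x)
    by_cases h5 : (C.lo x : ℕ) + 1 < C.hi x
    · obtain ⟨x', hx', hxs⟩ := exists_same_mem_tops h5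
      rw [h1, h2] at h5
      obtain ⟨y', hy', hys⟩ := exists_same_mem_tops h5
      obtain rfl : x' = y' := hinj hx' hy' (Prod.ext
        (hxs.1.symm.trans (h1.trans hys.1)) (hxs.2.1.symm.trans (h2.trans hys.2.1)))
      exact (hxs.trans hys.symm).2.2
    · by_cases h6 : (C.hi x : ℕ) = C.lo x + 1
      · exact hC' x y h1 h2 h6
      · have h7 : C.hi x = C.lo x := Fin.ext (by omega)
        exact Or.inl (C.le_of (by rw [h7, h1]))
  · rw [← hi, Finset.coe_filter]

end Coord

theorem krullDim_eq_of_strictMono {P : Type*} [PartialOrder P] {n : ℕ} {f : Fin (n + 1) → P}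
    {g : P → Fin (n + 1)} (hf : StrictMono f) (hg : StrictMono g) : Order.krullDim P = n := by
  apply le_antisymm
  · refine (Order.krullDim_le_of_strictMono g hg).trans (iSup_le fun p => ?_)
    have h := p.length_lt_card
    rw [Fintype.card_fin] at h
    exact_mod_cast Nat.lt_succ_iff.1 h
  · exact Order.LTSeries.length_le_krullDim (LTSeries.mk n f hf)

namespace Coord

/-! ### Height and counts of the basic block -/

section BasicBlock

variable {P : Type*} [PartialOrder P] [Finite P] {C : Coord P} {B : Set P}

/-- The existence of two hanging chains between consecutive members of the chain gives a chain of
length five in the basic block. -/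
theorem consecTotal_of_krullDim_eq (hC : C.Good) (hB : IsBasicBlockOf B)
    (hdim : Order.krullDim B = (4 : ℕ)) : C.ConsecTotal := by
  obtain ⟨hrep, -⟩ := represents_of_isBasicBlockOf hC hB
  intro x y h1 h2 h3
  by_contra h
  rw [not_or] at h
  obtain ⟨z, hz, hs⟩ := hrep.2 x ⟨y, h.1, h.2, h1.le, h2.ge⟩
  have hlt : C.lo z < C.hi z := by
    rw [← hs.1, ← hs.2.1, Fin.lt_def]
    omega
  have hzz : (C.hi z : ℕ) = C.lo z + 1 := by rw [← hs.1, ← hs.2.1, h3]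
  -- The surviving element `z` is inserted into the `5`-chain between its two consecutive ends.
  let f : Fin 6 → B := fun m =>
    if h : (m : ℕ) ≤ C.lo z then ⟨C.r ⟨m, by omega⟩, hrep.1 _⟩
    else if (m : ℕ) = C.lo z + 1 then ⟨z, hz⟩ else ⟨C.r ⟨m - 1, by omega⟩, hrep.1 _⟩
  have hf : StrictMono f := by
    intro m n hmn
    rw [Fin.lt_def] at hmn
    have hr : ∀ {a b : Fin 5}, (a : ℕ) < b → C.r a < C.r b := fun hab =>
      C.r_strictMono (Fin.lt_def.2 hab)
    have hlo : ∀ {a : Fin 5}, (a : ℕ) ≤ C.lo z → C.r a < z := fun ha =>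
      lt_of_le_of_lt (r_le_r.2 (Fin.le_def.2 ha)) (r_lo_lt hlt)
    have hhi : ∀ {a : Fin 5}, (C.lo z : ℕ) + 1 ≤ a → z < C.r a := fun ha =>
      lt_of_lt_of_le (lt_r_hi hlt) (r_le_r.2 (Fin.le_def.2 (by omega)))
    simp only [f]
    split_ifs with h1 h2 h3 h4 h5 h6 h7
    · exact hr hmn
    · exact hlo h1
    · exact hr (by dsimp only; omega)
    · omega
    · omega
    · exact hhi (by dsimp only; omega)
    · omega
    · omega
    · exact hr (by dsimp only; omega)
  have := Order.LTSeries.length_le_krullDim (LTSeries.mk 5 f hf)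
  rw [hdim] at this
  exact absurd (Nat.cast_le.1 this) (by simp)

variable {j : ℕ} {i : Fin 7}

/-- With nothing left to retract, each hanging chain is a single essential element, so its pair is
nonconsecutive. No essential chain has been lost, so the pairs that remain are those of `supp i`. -/
theorem count_restrict_eq_base (hC : C.PairTotal) (hj : 8 ≤ j) (hG : C.count ∈ family j i)
    (h : C.Represents B) (hB : ∀ x : B, ¬ Retractible x) : (C.restrict B h.1).count = base i := by
  have hgood := good_of_count_mem_family hj hG
  have hgood' := h.good_restrict hgood
  set D := C.restrict B h.1 with hD
  have hDtotal : D.PairTotal := fun x y hxy => hC x y hxy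
  have hle : ∀ p, D.count p ≤ 1 := by
    intro p
    rw [count, Finite.card_le_one_iff_subsingleton]
    refine ⟨?_⟩
    rintro ⟨x, hx⟩ ⟨y, hy⟩
    exact Subtype.ext (eq_of_same_of_forall_not_retractible hgood' hB
      (hDtotal.same_iff.2 (hx.trans hy.symm)))
  have hfar : ∀ x : B, D.lo x < D.hi x → D.pair x ∈ farPairs := fun x hx =>
    mem_farPairs.2 ((ess_of_forall_not_retractible hgood' hB hx).lo_add_one_lt_hi
      hDtotal.consecTotal)
  have hne : ∀ p ∈ farPairs, D.count p ≠ 0 ↔ p ∈ supp i := by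
    intro p hp
    rw [← ne_zero_iff_of_mem_family hj hG hp, count_ne_zero_iff, count_ne_zero_iff]
    constructor
    · rintro ⟨x, hx⟩
      exact ⟨x, hx⟩
    · rintro ⟨x, rfl⟩
      obtain ⟨y, hy, hs⟩ := h.2 x (ess_of_lo_add_one_lt_hi (mem_farPairs.1 hp))
      exact ⟨⟨y, hy⟩, Prod.ext hs.1.symm hs.2.1.symm⟩
  funext p
  obtain ⟨a, b⟩ := p
  rw [base]
  split_ifs with h1
  · rcases h1 with h1 | h1
    · obtain rfl : a = b := h1
      exact count_diag a
    · exact le_antisymm (hle _)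
        (Nat.one_le_iff_ne_zero.2 ((hne _ (supp_subset_farPairs i h1)).2 h1))
  · rw [not_or] at h1
    by_contra h2
    obtain ⟨x, hx⟩ := count_ne_zero_iff.1 h2
    have hlt : D.lo x < D.hi x := by
      refine lt_of_le_of_ne (D.lo_le_hi x) fun e => h1.1 ?_
      have h3 : D.lo x = a := congrArg Prod.fst hx
      have h4 : D.hi x = b := congrArg Prod.snd hx
      exact h3.symm.trans (e.trans h4)
    exact h1.2 ((hne _ (hx ▸ hfar x hlt)).1 h2)

theorem krullDim_of_count_eq_base (h : C.count = base i) : Order.krullDim P = (4 : ℕ) := by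
  have hcount : ∀ x, base i (C.pair x) ≠ 0 := by
    intro x
    rw [← h]
    exact count_ne_zero_iff.2 ⟨x, rfl⟩
  have hfar : ∀ x, C.lo x < C.hi x → (C.lo x : ℕ) + 1 < C.hi x := by
    intro x hx
    have h1 := hcount x
    rw [base] at h1
    split_ifs at h1 with h2
    · exact mem_farPairs.1 (supp_subset_farPairs i (h2.resolve_left hx.ne))
    · exact absurd rfl h1
  have hinj : ∀ x y, C.pair x = C.pair y → x = y := by
    intro x y hxy
    have h1 : C.count (C.pair y) ≤ 1 := by
      rw [h, base]
      split_ifs <;> omega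
    rw [count, Finite.card_le_one_iff_subsingleton] at h1
    have := Subsingleton.elim (⟨x, hxy⟩ : {z // C.pair z = C.pair y}) ⟨y, rfl⟩
    exact congrArg Subtype.val this
  -- Lower bound by the `5`-chain. The upper bound is a strictly monotone height: `lo x` on the
  -- chain and `lo x + 1` off it, which stays below `hi x` because off-chain elements have
  -- nonconsecutive ends.
  refine krullDim_eq_of_strictMono (n := 4) C.r_strictMono
    (g := fun x => ⟨if (C.lo x : ℕ) < C.hi x then C.lo x + 1 else C.lo x, by split_ifs <;> omega⟩) ?_
  intro x y hxy
  rw [Fin.lt_def]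
  dsimp only
  rcases C.of_le hxy.le with h1 | ⟨h1, h2⟩
  · have h2 := Fin.le_def.1 h1
    have h3 := Fin.le_def.1 (C.lo_le_hi x)
    have h4 := hfar x
    rw [Fin.lt_def] at h4
    have h5 : ¬ ((C.lo x : ℕ) = C.hi x ∧ (C.lo y : ℕ) = C.hi y ∧ (C.lo x : ℕ) = C.lo y) := by
      rintro ⟨h5, h6, h7⟩
      have h8 : (C.hi x : ℕ) = C.hi y := by omega
      exact hxy.ne (hinj x y (Prod.ext (Fin.ext h7) (Fin.ext h8)))
    have h6 := Fin.le_def.1 (C.lo_le_hi y)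
    split_ifs <;> omega
  · exact absurd (hinj x y (Prod.ext h1 h2)) hxy.ne

end BasicBlock

end Coord

/-! ### The seven basic blocks -/

/-- A labelling of a poset by pairs of indices which determines the order. -/
structure PairLabel (X : Type*) [PartialOrder X] where
  label : X → Fin 5 × Fin 5
  r : Fin 5 → X
  label_r : ∀ i, label (r i) = (i, i)
  fst_le_snd : ∀ x, (label x).1 ≤ (label x).2
  le_iff : ∀ {x y}, x ≤ y ↔ (label x).2 ≤ (label y).1 ∨ label x = label y

namespace PairLabel

section

variable {X : Type*} [PartialOrder X] (D : PairLabel X)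

theorem label_injective : Function.Injective D.label := fun _ _ h =>
  le_antisymm (D.le_iff.2 (Or.inr h)) (D.le_iff.2 (Or.inr h.symm))

/-- The coordinates given by a labelling. -/
def coord : Coord X where
  r := D.r
  lo x := (D.label x).1
  hi x := (D.label x).2
  lo_r i := by rw [D.label_r]
  hi_r i := by rw [D.label_r]
  lo_le_hi := D.fst_le_snd
  eq_r x h := D.label_injective (by rw [D.label_r]; exact Prod.ext rfl h.symm)
  le_of h := D.le_iff.2 (Or.inl h)
  of_le h := (D.le_iff.1 h).imp_right fun h => ⟨congrArg Prod.fst h, congrArg Prod.snd h⟩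
  up_total h1 h2 h3 h4 _ _ :=
    Or.inl (D.le_iff.2 (Or.inr (Prod.ext (h1.trans h3.symm) (h2.trans h4.symm))))
  down_total h1 h2 h3 h4 _ _ :=
    Or.inl (D.le_iff.2 (Or.inr (Prod.ext (h1.trans h3.symm) (h2.trans h4.symm))))

theorem pairTotal_coord : D.coord.PairTotal := fun _ _ h => Or.inl (D.le_iff.2 (Or.inr h))

theorem count_coord_eq_base {i : Fin 7} (h : ∀ p, p ∈ Set.range D.label ↔ p.1 = p.2 ∨ p ∈ supp i) :
    D.coord.count = base i := by
  funext p
  rw [base]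
  split_ifs with hp
  · obtain ⟨x, hx⟩ := (h p).2 hp
    rw [Coord.count, Nat.card_eq_one_iff_unique]
    exact ⟨⟨fun y z => Subtype.ext (D.label_injective (y.2.trans z.2.symm))⟩, ⟨⟨x, hx⟩⟩⟩
  · rw [Coord.count, Nat.card_eq_zero]
    exact Or.inl ⟨fun x => hp ((h p).1 ⟨x, x.2⟩)⟩

/-- The labelling of the dual. -/
def dual : PairLabel Xᵒᵈ where
  label x := ((D.label (OrderDual.ofDual x)).2.rev, (D.label (OrderDual.ofDual x)).1.rev)
  r i := OrderDual.toDual (D.r i.rev)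
  label_r i := by simp [D.label_r]
  fst_le_snd x := Fin.rev_le_rev.2 (D.fst_le_snd _)
  le_iff {x y} := by
    rw [← OrderDual.ofDual_le_ofDual, D.le_iff, Fin.rev_le_rev]
    refine or_congr_right ⟨fun h => by rw [h], fun h => ?_⟩
    exact Prod.ext (Fin.rev_injective (congrArg Prod.snd h).symm)
      (Fin.rev_injective (congrArg Prod.fst h).symm)

theorem mem_range_dual {p : Fin 5 × Fin 5} :
    p ∈ Set.range D.dual.label ↔ (p.2.rev, p.1.rev) ∈ Set.range D.label := by
  constructor
  · rintro ⟨x, rfl⟩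
    exact ⟨OrderDual.ofDual x, by simp [dual]⟩
  · rintro ⟨x, hx⟩
    refine ⟨OrderDual.toDual x, ?_⟩
    simp [dual, hx]

end

/-- The labelling of the `5`-chain. -/
def chain : PairLabel (Fin 5) where
  label x := (x, x)
  r := id
  label_r _ := rfl
  fst_le_snd _ := le_rfl
  le_iff {x y} := by
    rw [Prod.mk.injEq, and_self]
    exact ⟨Or.inl, fun h => h.elim id le_of_eq⟩

/-- The labelling of an adjunct. -/
def adjoin {X : Type} [PartialOrder X] (D : PairLabel X) (i k : Fin 5)
    (h : ∃ c, D.r i < c ∧ c < D.r k) (hp : (i, k) ∉ Set.range D.label) :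
    PairLabel (Adjunct X Unit (D.r i) (D.r k) h) where
  label x := Sum.elim D.label (fun _ => (i, k)) x.val
  r m := .left (D.r m)
  label_r := D.label_r
  fst_le_snd := by
    rintro ⟨x | x⟩
    · exact D.fst_le_snd x
    · obtain ⟨c, h1, h2⟩ := h
      exact (Coord.r_le_r (C := D.coord)).1 (h1.trans h2).le
  le_iff := by
    rintro ⟨x | x⟩ ⟨y | y⟩
    · exact D.le_iff
    · change x ≤ D.coord.r i ↔ (D.label x).2 ≤ i ∨ D.label x = (i, k)
      rw [Coord.le_r_iff, or_iff_left]
      · rfl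
      · exact fun h => hp ⟨x, h⟩
    · change D.coord.r k ≤ y ↔ k ≤ (D.label y).1 ∨ (i, k) = D.label y
      rw [Coord.r_le_iff, or_iff_left]
      · rfl
      · exact fun h => hp ⟨y, h.symm⟩
    · exact ⟨fun _ => Or.inr rfl, fun _ => le_refl x⟩

theorem mem_range_adjoin {X : Type} [PartialOrder X] (D : PairLabel X) {i k : Fin 5}
    {h : ∃ c, D.r i < c ∧ c < D.r k} {hp : (i, k) ∉ Set.range D.label} {p : Fin 5 × Fin 5} :
    p ∈ Set.range (D.adjoin i k h hp).label ↔ p ∈ Set.range D.label ∨ p = (i, k) := by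
  constructor
  · rintro ⟨⟨x | x⟩, rfl⟩
    · exact Or.inl ⟨x, rfl⟩
    · exact Or.inr rfl
  · rintro (⟨x, rfl⟩ | rfl)
    · exact ⟨⟨Sum.inl x⟩, rfl⟩
    · exact ⟨⟨Sum.inr ()⟩, rfl⟩

/-- The ends `a`, `b` are tied to the labelling only by equations, so the step can be iterated: the
pairs of a nested adjunct are images under `Adjunct.left` and match the new `r` only through the
recorded equations. -/
theorem exists_adjunct {X : Type} [PartialOrder X] (D : PairLabel X) {a b : X}
    (h : ∃ c, a < c ∧ c < b) {i k : Fin 5} (ha : D.r i = a) (hb : D.r k = b)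
    (hp : (i, k) ∉ Set.range D.label) :
    ∃ E : PairLabel (Adjunct X Unit a b h), (∀ m, E.r m = .left (D.r m)) ∧
      ∀ p, p ∈ Set.range E.label ↔ p ∈ Set.range D.label ∨ p = (i, k) := by
  subst ha hb
  exact ⟨D.adjoin i k h hp, fun _ => rfl, fun _ => D.mem_range_adjoin⟩

theorem mem_range_chain {p : Fin 5 × Fin 5} : p ∈ Set.range chain.label ↔ p.1 = p.2 :=
  ⟨by rintro ⟨x, rfl⟩; rfl, fun h => ⟨p.1, Prod.ext rfl h⟩⟩

theorem exists_tripleAdjunct {x₁ y₁ x₂ y₂ x₃ y₃ : Fin 5} (h₁ : ∃ c, x₁ < c ∧ c < y₁)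
    (h₂ : ∃ c, x₂ < c ∧ c < y₂) (h₃ : ∃ c, x₃ < c ∧ c < y₃)
    (h₁₂ : (x₂, y₂) ≠ (x₁, y₁)) (h₁₃ : (x₃, y₃) ≠ (x₁, y₁)) (h₂₃ : (x₃, y₃) ≠ (x₂, y₂)) :
    ∃ D : PairLabel (TripleAdjunct x₁ y₁ x₂ y₂ x₃ y₃ h₁ h₂ h₃),
      ∀ p, p ∈ Set.range D.label ↔ p.1 = p.2 ∨ p = (x₁, y₁) ∨ p = (x₂, y₂) ∨ p = (x₃, y₃) := by
  have hne : ∀ {x y : Fin 5}, (∃ c, x < c ∧ c < y) → x ≠ y := fun ⟨c, h, h'⟩ => (h.trans h').ne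
  obtain ⟨D₁, hr₁, hD₁⟩ := chain.exists_adjunct h₁ rfl rfl (by rw [mem_range_chain]; exact hne h₁)
  obtain ⟨D₂, hr₂, hD₂⟩ := D₁.exists_adjunct (Adjunct.exists_between_left h₂) (hr₁ _) (hr₁ _) (by
    rw [hD₁, mem_range_chain, not_or]; exact ⟨hne h₂, h₁₂⟩)
  obtain ⟨D₃, -, hD₃⟩ := D₂.exists_adjunct
    (Adjunct.exists_between_left (Adjunct.exists_between_left h₃))
    ((hr₂ _).trans (congrArg _ (hr₁ _))) ((hr₂ _).trans (congrArg _ (hr₁ _))) (by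
      rw [hD₂, hD₁, mem_range_chain, not_or, not_or]
      exact ⟨⟨hne h₃, h₁₃⟩, h₂₃⟩)
  exact ⟨D₃, fun p => by rw [hD₃, hD₂, hD₁, mem_range_chain, or_assoc, or_assoc]⟩

end PairLabel

theorem exists_pairLabel_basicBlock (i : Fin 7) : ∃ D : PairLabel (basicBlock i),
    ∀ p, p ∈ Set.range D.label ↔ p.1 = p.2 ∨ p ∈ supp i := by
  have h₁ : ∃ D : PairLabel B₁, ∀ p, p ∈ Set.range D.label ↔ p.1 = p.2 ∨ p ∈ supp 0 := by
    obtain ⟨D, hD⟩ := PairLabel.exists_tripleAdjunct (x₁ := 0) (y₁ := 2) (x₂ := 1) (y₂ := 3)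
      (x₃ := 1) (y₃ := 4) (by decide) (by decide) (by decide) (by decide) (by decide) (by decide)
    exact ⟨D, fun p => (hD p).trans (by revert p; decide)⟩
  have h₃ : ∃ D : PairLabel B₃, ∀ p, p ∈ Set.range D.label ↔ p.1 = p.2 ∨ p ∈ supp 2 := by
    obtain ⟨D, hD⟩ := PairLabel.exists_tripleAdjunct (x₁ := 0) (y₁ := 2) (x₂ := 1) (y₂ := 3)
      (x₃ := 0) (y₃ := 4) (by decide) (by decide) (by decide) (by decide) (by decide) (by decide)
    exact ⟨D, fun p => (hD p).trans (by revert p; decide)⟩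
  have h₅ : ∃ D : PairLabel B₅, ∀ p, p ∈ Set.range D.label ↔ p.1 = p.2 ∨ p ∈ supp 4 := by
    obtain ⟨D, hD⟩ := PairLabel.exists_tripleAdjunct (x₁ := 0) (y₁ := 2) (x₂ := 1) (y₂ := 3)
      (x₃ := 2) (y₃ := 4) (by decide) (by decide) (by decide) (by decide) (by decide) (by decide)
    exact ⟨D, fun p => (hD p).trans (by revert p; decide)⟩
  have h₆ : ∃ D : PairLabel B₆, ∀ p, p ∈ Set.range D.label ↔ p.1 = p.2 ∨ p ∈ supp 5 := by
    obtain ⟨D, hD⟩ := PairLabel.exists_tripleAdjunct (x₁ := 0) (y₁ := 3) (x₂ := 1) (y₂ := 4)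
      (x₃ := 2) (y₃ := 4) (by decide) (by decide) (by decide) (by decide) (by decide) (by decide)
    exact ⟨D, fun p => (hD p).trans (by revert p; decide)⟩
  have hdual : ∀ {X : Type} [PartialOrder X] {m n : Fin 7},
      (∃ D : PairLabel X, ∀ p, p ∈ Set.range D.label ↔ p.1 = p.2 ∨ p ∈ supp m) →
      (∀ p : Fin 5 × Fin 5, p.2.rev = p.1.rev ∨ (p.2.rev, p.1.rev) ∈ supp m ↔
        p.1 = p.2 ∨ p ∈ supp n) →
      ∃ D : PairLabel Xᵒᵈ, ∀ p, p ∈ Set.range D.label ↔ p.1 = p.2 ∨ p ∈ supp n := by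
    rintro X _ m n ⟨D, hD⟩ hmn
    exact ⟨D.dual, fun p => D.mem_range_dual.trans ((hD _).trans (hmn p))⟩
  match i with
  | 0 => exact h₁
  | 1 => exact hdual h₁ (by decide)
  | 2 => exact h₃
  | 3 => exact hdual h₃ (by decide)
  | 4 => exact h₅
  | 5 => exact h₆
  | 6 => exact hdual h₆ (by decide)

/-! ### Counting -/

/-- The substitution `t ↦ m + k - t` turns this into the hockey-stick identity. -/
theorem sum_Icc_choose_sub (m k : ℕ) :
    ∑ t ∈ Finset.Icc 1 m, (m + k - t).choose k = (m + k).choose (k + 1) := by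
  rcases Nat.eq_zero_or_pos m with rfl | hm
  · simp
  have h : ∑ t ∈ Finset.Icc 1 m, (m + k - t).choose k =
      ∑ t ∈ Finset.Icc k (m + k - 1), t.choose k := by
    refine Finset.sum_nbij' (fun t => m + k - t) (fun t => m + k - t) ?_ ?_ ?_ ?_
      fun _ _ => rfl <;> simp only [Finset.mem_Icc] <;> intro t ht <;> omega
  rw [h, Nat.sum_Icc_choose, show m + k - 1 + 1 = m + k by omega]

/-- The inner sum collapses to `5 * (j - s - 2).choose 5`, and the outer one to `5 * (j - 2).choose
6`. -/
theorem sum_formula {j : ℕ} (hj : 8 ≤ j) :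
    2 * (j - 2).choose 6 + ∑ s ∈ Finset.Icc 1 (j - 7), ∑ t ∈ Finset.Icc 1 (j - s - 6),
      5 * (j - t - s - 2).choose 4 = 7 * (j - 2).choose 6 := by
  have h1 : ∀ s ∈ Finset.Icc 1 (j - 7), ∑ t ∈ Finset.Icc 1 (j - s - 6),
      5 * (j - t - s - 2).choose 4 = 5 * (j - 7 + 5 - s).choose 5 := by
    intro s hs
    rw [Finset.mem_Icc] at hs
    rw [← Finset.mul_sum, show j - 7 + 5 - s = j - s - 6 + 4 by omega, ← sum_Icc_choose_sub]
    congr 1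
    refine Finset.sum_congr rfl fun t ht => ?_
    rw [Finset.mem_Icc] at ht
    congr 1
    omega
  rw [Finset.sum_congr rfl h1, ← Finset.mul_sum, sum_Icc_choose_sub,
    show j - 7 + 5 = j - 2 by omega]
  ring

namespace Coord

variable {P Q : Type*} [PartialOrder P] [PartialOrder Q] {C : Coord P}

theorem count_map (e : P ≃o Q) : (C.map e).count = C.count := by
  funext p
  exact Nat.card_congr (e.symm.toEquiv.subtypeEquiv fun _ => Iff.rfl)

theorem PairTotal.map (h : C.PairTotal) (e : P ≃o Q) : (C.map e).PairTotal := fun x y hxy => by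
  simpa using h (e.symm x) (e.symm y) hxy

end Coord

theorem base_mem_family (i : Fin 7) : base i ∈ family 8 i :=
  (mem_family le_rfl).2 ⟨sum_base i, fun _ => le_rfl, fun _ _ => rfl⟩

section

variable {j : ℕ} {i : Fin 7} {L : Type*} [Lattice L] [Finite L]

theorem isBlockOfType_of_count_mem_family (hj : 8 ≤ j) {C : Coord L} (hC : C.PairTotal)
    (h : C.count ∈ family j i) : IsBlockOfType L 5 3 :=
  isBlockOfType_of_coord (Coord.good_of_count_mem_family hj h) hC.consecTotal
    (hC.ncard_tops_of_count_mem_family hj h)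

theorem basicBlock_of_count_mem_family (hj : 8 ≤ j) {C : Coord L} (hC : C.PairTotal)
    (h : C.count ∈ family j i) {B : Set L} (hB : IsBasicBlockOf B) :
    Order.krullDim B = (4 : ℕ) ∧ Nonempty (B ≃o basicBlock i) := by
  obtain ⟨hrep, hB'⟩ := Coord.represents_of_isBasicBlockOf (Coord.good_of_count_mem_family hj h) hB
  have hcount := Coord.count_restrict_eq_base hC hj h hrep hB'
  obtain ⟨D, hD⟩ := exists_pairLabel_basicBlock i
  have : Finite (basicBlock i) := Finite.of_injective _ D.label_injective
  exact ⟨Coord.krullDim_of_count_eq_base hcount,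
    Coord.PairTotal.nonempty_orderIso_of_count_eq (fun x y hxy => hC x y hxy) D.pairTotal_coord
      (hcount.trans (D.count_coord_eq_base hD).symm)⟩

theorem exists_coord_of_krullDim (hj : 8 ≤ j) (hcard : Nat.card L = j) (hL : IsBlockOfType L 5 3)
    {B : Set L} (hB : IsBasicBlockOf B) (hdim : Order.krullDim B = (4 : ℕ)) :
    ∃ C : Coord L, C.PairTotal ∧ ∃ i, C.count ∈ family j i := by
  obtain ⟨C, hC⟩ := exists_coord hL.card_red hL.comparable hL.isBlock
  have hC' := Coord.consecTotal_of_krullDim_eq hC hB hdim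
  refine ⟨C, Coord.exists_pairTotal_count_mem_family hC hC' hj hcard ?_⟩
  have := hL.nullity_eq
  rw [Coord.nullity_eq_ncard_tops hC'] at this
  exact_mod_cast this

end

theorem krullDim_basicBlock (i : Fin 7) : Order.krullDim (basicBlock i) = (4 : ℕ) := by
  obtain ⟨D, hD⟩ := exists_pairLabel_basicBlock i
  have : Finite (basicBlock i) := Finite.of_injective _ D.label_injective
  exact Coord.krullDim_of_count_eq_base (D.count_coord_eq_base hD)

/-- The invariant counts of the basic blocks are the functions `base i`, whose supports tell the
seven blocks apart. -/
theorem eq_of_orderIso_basicBlock {i i' : Fin 7} (e : basicBlock i ≃o basicBlock i') : i = i' := by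
  obtain ⟨D, hD⟩ := exists_pairLabel_basicBlock i
  obtain ⟨D', hD'⟩ := exists_pairLabel_basicBlock i'
  have : Finite (basicBlock i) := Finite.of_injective _ D.label_injective
  have : Finite (basicBlock i') := Finite.of_injective _ D'.label_injective
  have hc := D.count_coord_eq_base hD
  have hc' := D'.count_coord_eq_base hD'
  have h := Coord.count_eq_of_orderIso
    (Coord.good_of_count_mem_family le_rfl (hc ▸ base_mem_family i))
    (Coord.good_of_count_mem_family le_rfl (hc' ▸ base_mem_family i')) e
  rw [hc, hc'] at h
  exact eq_of_mem_family le_rfl (base_mem_family i) (h ▸ base_mem_family i')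

/-- The isomorphism classes of the lattices with numbers of elements in a given set. -/
def classesOf (j : ℕ) (S : Finset (Fin 5 × Fin 5 → ℕ)) : Set (IsoClass j) :=
  {q | ∃ L : FinLattice j, ⟦L⟧ = q ∧ ∃ C : Coord L.Carrier, C.PairTotal ∧ C.count ∈ S}

theorem card_carrier {j : ℕ} (L : FinLattice j) : Nat.card L.Carrier = j := Nat.card_fin j

theorem exists_finLattice_of_mem_family {j : ℕ} (hj : 8 ≤ j) {i : Fin 7} {G : Fin 5 × Fin 5 → ℕ}
    (hG : G ∈ family j i) :
    ∃ L : FinLattice j, ∃ C : Coord L.Carrier, C.PairTotal ∧ C.count = G := by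
  have hcard : Nat.card (Model G) = j := by
    rw [Model.card_eq, eff_eq_of_mem_family hj hG, ((mem_family hj).1 hG).1]
  obtain ⟨L, ⟨e⟩⟩ := (Model.coord G).exists_finLattice hcard
  refine ⟨L, (Model.coord G).map e, Model.pairTotal_coord.map e, ?_⟩
  rw [Coord.count_map, Model.count_coord, eff_eq_of_mem_family hj hG]

/-- Each admissible count is realised by its model; invariance of the counts separates different
ones, and totality on equal indices makes the count determine the class. -/
theorem ncard_classesOf {j : ℕ} (hj : 8 ≤ j) {S : Finset (Fin 5 × Fin 5 → ℕ)}
    (hS : ∀ G ∈ S, ∃ i, G ∈ family j i) : (classesOf j S).ncard = S.card := by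
  have hex : ∀ G ∈ S, ∃ L : FinLattice j, ∃ C : Coord L.Carrier, C.PairTotal ∧ C.count = G :=
    fun G hG => exists_finLattice_of_mem_family hj (hS G hG).choose_spec
  choose L C hC hcount using hex
  rw [← Set.ncard_coe_finset]
  symm
  refine Set.ncard_congr (fun G hG => ⟦L G hG⟧) ?_ ?_ ?_
  · intro G hG
    exact ⟨L G hG, rfl, C G hG, hC G hG, (hcount G hG).symm ▸ hG⟩
  · intro G G' hG hG' h
    obtain ⟨e⟩ := Quotient.exact h
    obtain ⟨i, hi⟩ := hS G hG
    obtain ⟨i', hi'⟩ := hS G' hG'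
    rw [← hcount G hG] at hi
    rw [← hcount G' hG'] at hi'
    rw [← hcount G hG, ← hcount G' hG']
    exact Coord.count_eq_of_orderIso (Coord.good_of_count_mem_family hj hi)
      (Coord.good_of_count_mem_family hj hi') e
  · rintro q ⟨M, rfl, D, hD, hDS⟩
    exact ⟨D.count, hDS, Quotient.sound
      ((hC _ hDS).nonempty_orderIso_of_count_eq hD (hcount _ hDS))⟩

theorem blockClass_eq {j : ℕ} (hj : 8 ≤ j) :
    blockClass j 5 3 4 = classesOf j (Finset.univ.biUnion (family j)) := by
  ext q
  constructor
  · rintro ⟨L, rfl, hL, B, hB, hdim⟩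
    obtain ⟨C, hC, i, hi⟩ := exists_coord_of_krullDim hj (card_carrier L) hL hB hdim
    exact ⟨L, rfl, C, hC, Finset.mem_biUnion.2 ⟨i, Finset.mem_univ i, hi⟩⟩
  · rintro ⟨L, rfl, C, hC, h⟩
    obtain ⟨i, -, hi⟩ := Finset.mem_biUnion.1 h
    obtain ⟨B, hB⟩ := exists_isBasicBlockOf L.Carrier
    exact ⟨L, rfl, isBlockOfType_of_count_mem_family hj hC hi, B, hB,
      (basicBlock_of_count_mem_family hj hC hi hB).1⟩

theorem blockClassOf_eq {j : ℕ} (hj : 8 ≤ j) (i : Fin 7) :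
    blockClassOf (basicBlock i) j 5 3 = classesOf j (family j i) := by
  ext q
  constructor
  · rintro ⟨L, rfl, hL, B, hB, ⟨e⟩⟩
    have hdim : Order.krullDim B = (4 : ℕ) :=
      (Order.krullDim_eq_of_orderIso e).trans (krullDim_basicBlock i)
    obtain ⟨C, hC, i', hi'⟩ := exists_coord_of_krullDim hj (card_carrier L) hL hB hdim
    obtain ⟨-, ⟨e'⟩⟩ := basicBlock_of_count_mem_family hj hC hi' hB
    -- The same set `B` is isomorphic to the prescribed basic block and to the one read off from the
    -- counts.
    obtain rfl := eq_of_orderIso_basicBlock (e.symm.trans e')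
    exact ⟨L, rfl, C, hC, hi'⟩
  · rintro ⟨L, rfl, C, hC, hi⟩
    obtain ⟨B, hB⟩ := exists_isBasicBlockOf L.Carrier
    exact ⟨L, rfl, isBlockOfType_of_count_mem_family hj hC hi, B, hB,
      (basicBlock_of_count_mem_family hj hC hi hB).2⟩

theorem ncard_blockClassOf {j : ℕ} (hj : 8 ≤ j) (i : Fin 7) :
    (blockClassOf (basicBlock i) j 5 3).ncard = (j - 2).choose 6 := by
  rw [blockClassOf_eq hj, ncard_classesOf hj fun G hG => ⟨i, hG⟩, card_family hj]

theorem ncard_blockClass {j : ℕ} (hj : 8 ≤ j) :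
    (blockClass j 5 3 4).ncard = 7 * (j - 2).choose 6 := by
  rw [blockClass_eq hj, ncard_classesOf hj fun G hG => by simpa using hG, Finset.card_biUnion]
  · simp [card_family hj]
  · intro i _ i' _ hne
    exact Finset.disjoint_left.2 fun G hG hG' => hne (eq_of_mem_family hj hG hG')

end LatticeCount

theorem mainTheorem3 (j : ℕ) (hj : 8 ≤ j) :
    (LatticeCount.blockClass j 5 3 4).ncard =
        2 * (j - 2).choose 6 +
          ∑ s ∈ Finset.Icc 1 (j - 7), ∑ t ∈ Finset.Icc 1 (j - s - 6),
            5 * (j - t - s - 2).choose 4 ∧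
      (LatticeCount.blockClass j 5 3 4).ncard =
        ∑ i : Fin 7, (LatticeCount.blockClassOf (LatticeCount.basicBlock i) j 5 3).ncard := by
  rw [LatticeCount.sum_formula hj, LatticeCount.ncard_blockClass hj]
  simp [LatticeCount.ncard_blockClassOf hj]
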